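/- **Setting.** A *compact PL pair* $(Z/Y)$ is a pair homeomorphic to a pair $Q\subseteq P$ of compact polyhedra (finite unions of convex polytopes in some $\mathbb R^m$). Let $\varrho$ be a *curvature map*: it assigns to each compact PL pair a real number depending only on the homeomorphism class of the pair, with $\varrho\big((Z/Y)\sqcup(Z'/Y')\big)=\varrho(Z/Y)+\varrho(Z'/Y')$, $\varrho\big(Z\times Z'\,/\,Z\times Y'\cup Y\times Z'\big)=\varrho(Z/Y)\,\varrho(Z'/Y')$, $\varrho(\mathrm{pt}/\mathrm{pt})=0$ and $\varrho(\mathrm{pt}/\emptyset)=1$. Let $E$ be a finite-dimensional euclidean space with unit sphere $S$. For $X\subseteq E$ and $x,a\in E$ put $\varrho(X,x,a)=\varrho\big(C/L\big)$ with $C=\{y\in X: |y-x|\le r,\ |\langle y-x,a\rangle|\le\delta\}$ and $L=\{y\in X: |y-x|\le r,\ \langle y-x,a\rangle=\delta\}$, where $r>0$ is small and $0<\delta\ll r$, and put $\varrho(X,x)=|S|^{-1}\int_S\varrho(X,x,a)\,da$. If $X$ is the underlying space of a finite simplicial complex in $E$, $F$ is a face of it and $x\in\operatorname{Int}(F)$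 (relative interior), let $N$ be the orthogonal complement of the direction space of $F$ and let $\varrho(X,F)$ be the mean of $\varrho(X\cap(x+N),x,a)$ over the unit vectors $a\in N$. Means over the unit sphere of a zero-dimensional space are read as the value at $a=0$. **Proposition.** Let $X_1,X_2\subset E$ be underlying spaces of finite simplicial complexes, let $F_i$ be a face of $X_i$ and let $E_i$ be the linear span of $F_i$ $(i=1,2)$. Assume $\operatorname{Int}(F_1)\cap\operatorname{Int}(F_2)=\{0\}$ and $E=E_1\oplus E_2$ (not necessarily orthogonal). Then $\varrho(X_1,F_1)$ and $\varrho(X_2,F_2)$ do not depend on the points $x$ of $\operatorname{Int}(F_i)$ used to compute them, and the following hold. (a) Let $j_2:E_2\to E_1^\perp$ and $j_1:E_1\to E_2^\perp$ be any linear isometries onto. Let $g_2\in O(E_2)$ act on $E$ as the identity on $E_1$ and as $j_2g_2j_2^{-1}$ on $E_1^\perp$, and let $g_1\in O(E_1)$ act on $E$ as the identity on $E_2$ and as $j_1g_1j_1^{-1}$ on $E_2^\perp$. With respect to the Haar probability measures, $(g_1,g_2)\mapsto\varrho(g_2X_1\cap g_1X_2,0)$ is integrable and $$\int_{O(E_1)\times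 O(E_2)}\varrho(g_2X_1\cap g_1X_2,\,0)\,dg_1\,dg_2=\varrho(X_1\cap E_1^\perp,0)\,\varrho(X_2\cap E_2^\perp,0)=\varrho(X_1,F_1)\,\varrho(X_2,F_2).$$ (b) If $E_1\perp E_2$, then without averaging $$\varrho(X_1\cap X_2,0)=\varrho(X_1\cap E_2,0)\,\varrho(X_2\cap E_1,0)=\varrho(X_1,F_1)\,\varrho(X_2,F_2).$$ -/

import Mathlib

open MeasureTheory Filter Topology Set Geometry
open scoped InnerProductSpace

noncomputable section

namespace PLCurvature

universe u

/-- A compact polyhedron: a finite union of convex polytopes. -/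
def IsCompactPolyhedron {V : Type*} [AddCommGroup V] [Module ℝ V] (P : Set V) : Prop :=
  ∃ T : Finset (Finset V), P = ⋃ t ∈ T, convexHull ℝ (t : Set V)

/-- `(Z / Y)` is a pair of compact PL spaces: up to homeomorphism of pairs it is a pair `Q ⊆ P` of
compact polyhedra in some euclidean space. -/
def IsPLPair (Z : Type u) [TopologicalSpace Z] (Y : Set Z) : Prop :=
  ∃ (m : ℕ) (P Q : Set (EuclideanSpace ℝ (Fin m))),
    IsCompactPolyhedron P ∧ IsCompactPolyhedron Q ∧ Q ⊆ P ∧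
      ∃ e : Z ≃ₜ P, (fun z => (e z : EuclideanSpace ℝ (Fin m))) '' Y = Q

/-- A curvature map: a real invariant of pairs of compact PL spaces up to homeomorphism of pairs,
additive on disjoint unions, multiplicative on products, and normalized on a singleton.
All laws are imposed on PL pairs only; the values on other pairs are irrelevant. -/
structure CurvatureMap : Type (u + 1) where
  /-- the value `ϱ(Z / Y)` -/
  val : (Z : Type u) → [TopologicalSpace Z] → Set Z → ℝ
  val_homeo : ∀ (Z Z' : Type u) [TopologicalSpace Z] [TopologicalSpace Z'] (Y : Set Z)
    (e : Z ≃ₜ Z'), IsPLPair Z Y → val Z' (e '' Y) = val Z Y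
  val_sum : ∀ (Z Z' : Type u) [TopologicalSpace Z] [TopologicalSpace Z'] (Y : Set Z) (Y' : Set Z'),
    IsPLPair Z Y → IsPLPair Z' Y' →
      val (Z ⊕ Z') (Sum.inl '' Y ∪ Sum.inr '' Y') = val Z Y + val Z' Y'
  val_prod : ∀ (Z Z' : Type u) [TopologicalSpace Z] [TopologicalSpace Z'] (Y : Set Z) (Y' : Set Z'),
    IsPLPair Z Y → IsPLPair Z' Y' →
      val (Z × Z') (univ ×ˢ Y' ∪ Y ×ˢ univ) = val Z Y * val Z' Y'
  val_point_self : val PUnit univ = 0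
  val_point_empty : val PUnit ∅ = 1

section Sphere

variable {V : Type*} [NormedAddCommGroup V] [InnerProductSpace ℝ V] [FiniteDimensional ℝ V]
  [MeasurableSpace V] [BorelSpace V]

/-- The mean `|S|⁻¹ ∫_S f(a) da` over the unit sphere `S` of `V` with its surface measure.
If `V = 0` this sphere is empty; the convention is then to evaluate at the only direction `0`
(where the link of a point is empty, so that an isolated point gets the value `ϱ(x, ∅) = 1`). -/
def sphereMean (f : V → ℝ) : ℝ :=
  if Module.finrank ℝ V = 0 then f 0
  else ⨍ a : Metric.sphere (0 : V) 1, f a ∂(volume : Measure V).toSphere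

end Sphere

section Curvature

variable {E : Type u} [NormedAddCommGroup E] [InnerProductSpace ℝ E]

/-- The cone `C(X, x, a)` of `X` at `x` in direction `a`, with parameters `r` and `δ`. -/
def dirCone (X : Set E) (x a : E) (r δ : ℝ) : Set E :=
  {y | y ∈ X ∩ Metric.closedBall x r ∧ -δ ≤ ⟪y - x, a⟫_ℝ ∧ ⟪y - x, a⟫_ℝ ≤ δ}

/-- The link `L(X, x, a)` of `X` at `x` in direction `a`, with parameters `r` and `δ`. -/
def dirLink (X : Set E) (x a : E) (r δ : ℝ) : Set E :=
  {y | y ∈ X ∩ Metric.closedBall x r ∧ ⟪y - x, a⟫_ℝ = δ}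

namespace CurvatureMap

variable (ρ : CurvatureMap.{u})

/-- `c` is the value of `ϱ(C(X, x, a) / L(X, x, a))` for all small `r > 0` and all
`0 < δ ≪ r`. -/
def IsIndex (X : Set E) (x a : E) (c : ℝ) : Prop :=
  ∀ᶠ r in 𝓝[>] (0 : ℝ), ∀ᶠ δ in 𝓝[>] (0 : ℝ),
    ρ.val (dirCone X x a r δ) ((↑) ⁻¹' dirLink X x a r δ) = c

/-- The number in `IsIndex` is unique. -/
theorem IsIndex.unique {ρ : CurvatureMap.{u}} {X : Set E} {x a : E} {c c' : ℝ}
    (h : ρ.IsIndex X x a c) (h' : ρ.IsIndex X x a c') : c = c' := by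
  obtain ⟨r, hr, hr'⟩ := (Filter.Eventually.and h h').exists
  obtain ⟨δ, hδ, hδ'⟩ := (hr.and hr').exists
  exact hδ.symm.trans hδ'

open Classical in
/-- `ϱ(X, x, a) = ϱ(C(X, x, a) / L(X, x, a))`, for small `r` and `0 < δ ≪ r`
(for a polyhedron the value does not depend on their choice). -/
def index (X : Set E) (x a : E) : ℝ :=
  if h : ∃ c, ρ.IsIndex X x a c then h.choose else 0

/-- `ρ.index` is the common value whenever there is one. -/
theorem IsIndex.index_eq {ρ : CurvatureMap.{u}} {X : Set E} {x a : E} {c : ℝ}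
    (h : ρ.IsIndex X x a c) : ρ.index X x a = c := by
  have h' : ∃ c, ρ.IsIndex X x a c := ⟨c, h⟩
  rw [index, dif_pos h']
  exact h'.choose_spec.unique h

variable [FiniteDimensional ℝ E] [MeasurableSpace E] [BorelSpace E]

/-- `ϱ(X, x) = |S|⁻¹ ∫_S ϱ(X, x, a) da`: the mass at `x` of the curvature measure of `X`; here `S`
is the unit sphere of the ambient space. -/
def curvatureAt (X : Set E) (x : E) : ℝ :=
  sphereMean fun a : E => ρ.index X x a

/-- `ϱ(X, F)` for a face `F` of `X`, computed at the interior point `x` of `F`: the mean of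
`ϱ(X ∩ Aff(F)^⊥, x, a)` over the unit sphere of the directions orthogonal to `F`, where
`Aff(F)^⊥` is the affine orthogonal complement of `Aff(F)` through `x`. -/
def faceCurvature (X F : Set E) (x : E) : ℝ :=
  sphereMean fun a : ((vectorSpan ℝ F)ᗮ : Submodule ℝ E) =>
    ρ.index (X ∩ AffineSubspace.mk' x (vectorSpan ℝ F)ᗮ) x (a : E)

end CurvatureMap

end Curvature

section OrthogonalGroup

variable (V : Type*) [NormedAddCommGroup V] [InnerProductSpace ℝ V] [FiniteDimensional ℝ V]

/-- The orthogonal group `O(V)`, with the topology of the operator norm. -/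
abbrev OrthGroup : Type _ := unitary (V →L[ℝ] V)

instance : CompactSpace (OrthGroup V) := by
  apply isCompact_iff_compactSpace.mp
  refine Metric.isCompact_of_isClosed_isBounded isClosed_unitary ?_
  refine (Metric.isBounded_closedBall (x := (0 : V →L[ℝ] V)) (r := 1)).subset fun u hu => ?_
  rw [mem_closedBall_zero_iff]
  refine ContinuousLinearMap.opNorm_le_bound _ zero_le_one fun v => ?_
  rw [one_mul, ContinuousLinearMap.norm_map_of_mem_unitary hu]

/-- The Haar probability measure of `O(V)`. -/
def orthHaar : Measure (OrthGroup V) := Measure.haarMeasure ⊤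

instance : IsProbabilityMeasure (orthHaar V) := ⟨Measure.haarMeasure_self⟩

instance : (orthHaar V).IsHaarMeasure := Measure.isHaarMeasure_haarMeasure ⊤

end OrthogonalGroup

section Rotation

variable {E : Type*} [NormedAddCommGroup E] [InnerProductSpace ℝ E] [FiniteDimensional ℝ E]

/-- The action on `E` of `g ∈ O(W)` as an isometry that fixes the subspace `U` pointwise, where
`W` is identified with the orthogonal complement of `U` by the linear isometry `j`:
it is the identity on `U` and `j ∘ g ∘ j⁻¹` on `Uᗮ`. -/
def actFixing (U : Submodule ℝ E) {W : Submodule ℝ E} (j : W ≃ₗᵢ[ℝ] Uᗮ) (g : OrthGroup W)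
    (y : E) : E :=
  (U.orthogonalProjectionOnto y : E) +
    (j ((g : W →L[ℝ] W) (j.symm (Uᗮ.orthogonalProjectionOnto y))) : E)

end Rotation

end PLCurvature

end

/-!
Near a point `x` of the relative interior of a face `F` with direction space `U`, a finite
simplicial complex is invariant under small translations along `U`, and its projection to `Uᗮ` is
a simplicial fan: its cones are spanned by the projections `w i` of the vertices of the faces in
the star of `F`, and the nonnegative coefficients of a point of the fan are unique. The cones and
their generators are the same for every interior point of `F`, which gives the independence of the
base point (`isNormalFanAt_space`).

For a set that is locally a simplicial fan, the pair `(C / L)` in direction `a` is homeomorphic to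
a pair of unions of faces of a cube: the coefficient vectors with entries at most `1`, relative to
those in which some generator of positive height `⟪w i, a⟫` has coefficient `1`
(`IsFanAt.isIndex`). The homeomorphism is a rescaling, which treats the coefficients of the
generators of positive height and the remaining ones separately, since a single radial rescaling
would not match both the truncation by the ball and the one by the slab. So the index in direction
`a` depends only on the combinatorics of the fan and on the set of generators of positive height;
it is a bounded measurable function `fanIndex` of `a`, constant along rays, and it depends only on
the projection of `a` to `Uᗮ`.

If `E = U ⊕ V`, then `E` is identified with `Uᗮ × Vᗮ`, and near the origin the intersection of two
sets with normal fans along `U` and `V` is the product of the two fans. The cubical model of a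
product is the product of the models, so multiplicativity of the curvature map turns the index of
the intersection into a product of two values of `fanIndex`, at the components of `a` in `Uᗮ` and
`Vᗮ` (`index_inter_eq`). Acting with `g₂` and `g₁` rotates these two components independently. As
the orthogonal group is transitive on the sphere, the average of `fanIndex` over a nonzero orbit
is its mean over the sphere (`integral_orthGroup_inv_apply`), and Fubini's theorem gives the
averaged formula. The mean over the sphere of `Uᗮ` agrees with the mean over the sphere of `E`,
because the projection of the latter measure to `Uᗮ` is rotation invariant and, unless `Uᗮ = 0`,
has no mass at the origin. If `U ⟂ V`, the rotations act on the intersection by isometries of `E`,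
so that its curvature is constant and equal to its average.
-/

noncomputable section

namespace PLCurvature

universe u

/-! ### Compact polyhedra -/

section Polyhedra

variable {V W : Type*} [AddCommGroup V] [Module ℝ V] [AddCommGroup W] [Module ℝ W]

theorem isCompactPolyhedron_convexHull {s : Set V} (hs : s.Finite) :
    IsCompactPolyhedron (convexHull ℝ s) :=
  ⟨{hs.toFinset}, by simp⟩

theorem IsCompactPolyhedron.biUnion {κ : Type*} {I : Set κ} (hI : I.Finite) {P : κ → Set V}
    (h : ∀ i ∈ I, IsCompactPolyhedron (P i)) : IsCompactPolyhedron (⋃ i ∈ I, P i) := by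
  classical
  choose! T hT using h
  refine ⟨hI.toFinset.biUnion T, ?_⟩
  ext x
  simp only [mem_iUnion, Finset.mem_biUnion, Finite.mem_toFinset, exists_prop]
  constructor
  · rintro ⟨i, hi, hx⟩
    rw [hT i hi] at hx
    simp only [mem_iUnion, exists_prop] at hx
    obtain ⟨t, ht, hx⟩ := hx
    exact ⟨t, ⟨i, hi, ht⟩, hx⟩
  · rintro ⟨t, ⟨i, hi, ht⟩, hx⟩
    refine ⟨i, hi, ?_⟩
    rw [hT i hi]
    simp only [mem_iUnion, exists_prop]
    exact ⟨t, ht, hx⟩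

theorem IsCompactPolyhedron.image {P : Set V} (hP : IsCompactPolyhedron P) (f : V →ₗ[ℝ] W) :
    IsCompactPolyhedron (f '' P) := by
  classical
  obtain ⟨T, rfl⟩ := hP
  rw [image_iUnion₂]
  refine IsCompactPolyhedron.biUnion T.finite_toSet fun t _ => ?_
  rw [f.image_convexHull]
  exact isCompactPolyhedron_convexHull (t.finite_toSet.image _)

/-- A box `∏ [l i, u i]` is the convex hull of its finitely many corners. -/
theorem isCompactPolyhedron_Icc {ι : Type*} [Finite ι] {l u : ι → ℝ} (h : l ≤ u) :
    IsCompactPolyhedron (Icc l u) := by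
  have : Icc l u = convexHull ℝ (pi univ fun i => ({l i, u i} : Set ℝ)) := by
    rw [convexHull_pi, ← pi_univ_Icc]
    congr 1
    ext1 i
    rw [convexHull_pair, segment_eq_Icc (h i)]
  rw [this]
  exact isCompactPolyhedron_convexHull (Finite.pi fun i => toFinite _)

/-- A pair of compact polyhedra in a coordinate space is a compact PL pair. -/
theorem isPLPair_of_isCompactPolyhedron {ι : Type*} [Fintype ι] {P Q : Set (ι → ℝ)}
    (hP : IsCompactPolyhedron P) (hQ : IsCompactPolyhedron Q) (hQP : Q ⊆ P) :
    IsPLPair P ((↑) ⁻¹' Q : Set P) := by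
  let L : (ι → ℝ) ≃L[ℝ] EuclideanSpace ℝ (Fin (Fintype.card ι)) :=
    (ContinuousLinearEquiv.piCongrLeft ℝ (fun _ => ℝ) (Fintype.equivFin ι)).trans
      (EuclideanSpace.equiv (Fin (Fintype.card ι)) ℝ).symm
  refine ⟨_, L '' P, L '' Q, hP.image L.toLinearEquiv.toLinearMap,
    hQ.image L.toLinearEquiv.toLinearMap, image_mono hQP, L.toHomeomorph.image P, ?_⟩
  ext y
  constructor
  · rintro ⟨⟨c, hc⟩, hcQ, rfl⟩
    exact ⟨c, hcQ, rfl⟩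
  · rintro ⟨c, hc, rfl⟩
    exact ⟨⟨c, hQP hc⟩, hc, rfl⟩

end Polyhedra

/-! ### The cubical model of a simplicial fan -/

section Model

variable {ι κ : Type u}

/-- The coordinate fan of a family `𝒦` of index sets: the nonnegative vectors that are supported
in a member of `𝒦`. -/
def supportCone (𝒦 : Set (Finset ι)) : Set (ι → ℝ) :=
  {c | (∀ i, 0 ≤ c i) ∧ ∃ s ∈ 𝒦, ∀ i ∉ s, c i = 0}

/-- The part of the coordinate fan in the unit cube; it is a union of faces of the cube. -/
def supportCube (𝒦 : Set (Finset ι)) : Set (ι → ℝ) :=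
  {c | c ∈ supportCone 𝒦 ∧ ∀ i, c i ≤ 1}

/-- The part of `supportCube 𝒦` in the faces `c i = 1` of the cube with `i ∈ S`. -/
def supportCubeFace (𝒦 : Set (Finset ι)) (S : Set ι) : Set (ι → ℝ) :=
  {c | c ∈ supportCube 𝒦 ∧ ∃ i ∈ S, c i = 1}

/-- The value of the curvature map on the cubical model pair. -/
def CurvatureMap.modelValue (ρ : CurvatureMap.{u}) (𝒦 : Set (Finset ι)) (S : Set ι) : ℝ :=
  ρ.val (supportCube 𝒦) ((↑) ⁻¹' supportCubeFace 𝒦 S)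

open Classical in
theorem isPLPair_supportCube [Fintype ι] (𝒦 : Set (Finset ι)) (S : Set ι) :
    IsPLPair (supportCube 𝒦) ((↑) ⁻¹' supportCubeFace 𝒦 S : Set (supportCube 𝒦)) := by
  refine isPLPair_of_isCompactPolyhedron ?_ ?_ fun c hc => hc.1
  · have : supportCube 𝒦 =
        ⋃ s ∈ 𝒦, Icc (0 : ι → ℝ) (fun i => if i ∈ s then 1 else 0) := by
      ext c
      simp only [supportCube, supportCone, mem_ofPred_eq, mem_iUnion, mem_Icc, Pi.le_def,
        Pi.zero_apply, exists_prop]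
      constructor
      · rintro ⟨⟨h0, s, hs, hsc⟩, h1⟩
        refine ⟨s, hs, h0, fun i => ?_⟩
        split_ifs with hi
        exacts [h1 i, (hsc i hi).le]
      · rintro ⟨s, hs, h0, h1⟩
        refine ⟨⟨h0, s, hs, fun i hi => le_antisymm ?_ (h0 i)⟩, fun i => (h1 i).trans ?_⟩
        · simpa [hi] using h1 i
        · split_ifs <;> norm_num
    rw [this]
    refine IsCompactPolyhedron.biUnion (toFinite _) fun s _ => isCompactPolyhedron_Icc fun i => ?_
    dsimp only [Pi.zero_apply]
    split_ifs <;> norm_num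
  · have : supportCubeFace 𝒦 S = ⋃ p ∈ {p : Finset ι × ι | p.1 ∈ 𝒦 ∧ p.2 ∈ S ∧ p.2 ∈ p.1},
        Icc (fun i => if i = p.2 then 1 else 0) (fun i => if i ∈ p.1 then (1 : ℝ) else 0) := by
      ext c
      simp only [supportCubeFace, supportCube, supportCone, mem_ofPred_eq, mem_iUnion, mem_Icc,
        Pi.le_def, exists_prop, Prod.exists]
      constructor
      · rintro ⟨⟨⟨h0, s, hs, hsc⟩, h1⟩, i, hi, hci⟩
        refine ⟨s, i, ⟨hs, hi, ?_⟩, fun j => ?_, fun j => ?_⟩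
        · by_contra his
          have := hsc i his
          linarith
        · split_ifs with hj
          exacts [hj ▸ hci.ge, h0 j]
        · split_ifs with hj
          exacts [h1 j, (hsc j hj).le]
      · rintro ⟨s, i, ⟨hs, hi, his⟩, h0, h1⟩
        have h0' : ∀ j, 0 ≤ c j := fun j => le_trans (by split_ifs <;> norm_num) (h0 j)
        have h1' : ∀ j, c j ≤ 1 := fun j => (h1 j).trans (by split_ifs <;> norm_num)
        refine ⟨⟨⟨h0', s, hs, fun j hj => le_antisymm ?_ (h0' j)⟩, h1'⟩, i, hi,
          le_antisymm (h1' i) ?_⟩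
        · simpa [hj] using h1 j
        · simpa using h0 i
    rw [this]
    refine IsCompactPolyhedron.biUnion (toFinite _) fun p hp => isCompactPolyhedron_Icc fun i => ?_
    dsimp only
    split_ifs with h1 h2 h2
    · exact le_rfl
    · exact absurd (h1 ▸ hp.2.2) h2
    · norm_num
    · exact le_rfl

/-- The join of two families of index sets. -/
def joinFamily (𝒦 : Set (Finset ι)) (ℒ : Set (Finset κ)) : Set (Finset (ι ⊕ κ)) :=
  {u | ∃ s ∈ 𝒦, ∃ t ∈ ℒ, u = s.disjSum t}

theorem mem_supportCone_joinFamily {𝒦 : Set (Finset ι)} {ℒ : Set (Finset κ)} {c : ι ⊕ κ → ℝ} :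
    c ∈ supportCone (joinFamily 𝒦 ℒ) ↔
      (fun i => c (.inl i)) ∈ supportCone 𝒦 ∧ (fun j => c (.inr j)) ∈ supportCone ℒ := by
  constructor
  · rintro ⟨h0, _, ⟨s, hs, t, ht, rfl⟩, hc⟩
    exact ⟨⟨fun i => h0 _, s, hs, fun i hi => hc _ (by simpa using hi)⟩,
      ⟨fun i => h0 _, t, ht, fun i hi => hc _ (by simpa using hi)⟩⟩
  · rintro ⟨⟨h0, s, hs, hsc⟩, ⟨h0', t, ht, htc⟩⟩
    refine ⟨?_, _, ⟨s, hs, t, ht, rfl⟩, ?_⟩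
    · rintro (i | j)
      exacts [h0 i, h0' j]
    · rintro (i | j) h
      exacts [hsc i (by simpa using h), htc j (by simpa using h)]

/-- The model pair of a join is the product of the model pairs. -/
theorem CurvatureMap.modelValue_joinFamily [Fintype ι] [Fintype κ] (ρ : CurvatureMap.{u})
    (𝒦 : Set (Finset ι)) (ℒ : Set (Finset κ)) (U : Set (ι ⊕ κ)) :
    ρ.modelValue (joinFamily 𝒦 ℒ) U =
      ρ.modelValue 𝒦 (Sum.inl ⁻¹' U) * ρ.modelValue ℒ (Sum.inr ⁻¹' U) := by
  have key : ∀ c : ι ⊕ κ → ℝ, c ∈ supportCube (joinFamily 𝒦 ℒ) ↔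
      (fun i => c (.inl i)) ∈ supportCube 𝒦 ∧ (fun j => c (.inr j)) ∈ supportCube ℒ := by
    intro c
    simp only [supportCube, mem_ofPred_eq, mem_supportCone_joinFamily, Sum.forall]
    tauto
  let e : supportCube (joinFamily 𝒦 ℒ) ≃ₜ supportCube 𝒦 × supportCube ℒ :=
    { toFun := fun c => (⟨fun i => c.1 (.inl i), ((key _).1 c.2).1⟩,
        ⟨fun i => c.1 (.inr i), ((key _).1 c.2).2⟩)
      invFun := fun p => ⟨Sum.elim p.1.1 p.2.1, (key _).2 ⟨p.1.2, p.2.2⟩⟩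
      left_inv := fun c => by
        ext i
        rcases i with i | i <;> rfl
      right_inv := fun p => rfl
      continuous_toFun := by
        refine (Continuous.subtype_mk (continuous_pi fun i => ?_) _).prodMk
          (Continuous.subtype_mk (continuous_pi fun i => ?_) _)
        · exact (continuous_apply _).comp continuous_subtype_val
        · exact (continuous_apply _).comp continuous_subtype_val
      continuous_invFun := by
        refine Continuous.subtype_mk (continuous_pi ?_) _
        rintro (i | i)
        · exact (continuous_apply i).comp (continuous_subtype_val.comp continuous_fst)
        · exact (continuous_apply i).comp (continuous_subtype_val.comp continuous_snd) }
  rw [CurvatureMap.modelValue, CurvatureMap.modelValue, CurvatureMap.modelValue,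
    ← ρ.val_prod _ _ _ _ (isPLPair_supportCube _ _) (isPLPair_supportCube _ _),
    ← ρ.val_homeo _ _ _ e (isPLPair_supportCube _ _)]
  congr 1
  rw [← e.preimage_symm]
  ext p
  simp only [mem_preimage, mem_union, mem_prod, mem_univ, true_and, and_true, supportCubeFace,
    mem_ofPred_eq, Subtype.coe_prop, Sum.exists]
  exact or_comm

theorem smul_mem_supportCone {𝒦 : Set (Finset ι)} {c : ι → ℝ} (hc : c ∈ supportCone 𝒦) {t : ℝ}
    (ht : 0 ≤ t) : t • c ∈ supportCone 𝒦 := by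
  obtain ⟨h0, s, hs, hsc⟩ := hc
  exact ⟨fun i => mul_nonneg ht (h0 i), s, hs, fun i hi => by simp [hsc i hi]⟩

theorem zero_mem_supportCone {𝒦 : Set (Finset ι)} (h : 𝒦.Nonempty) : 0 ∈ supportCone 𝒦 :=
  ⟨fun _ => le_rfl, h.some, h.some_mem, fun _ _ => rfl⟩

theorem isClosed_supportCone [Fintype ι] (𝒦 : Set (Finset ι)) : IsClosed (supportCone 𝒦) := by
  have : supportCone 𝒦 =
      ⋃ s ∈ 𝒦, {c : ι → ℝ | (∀ i, 0 ≤ c i) ∧ ∀ i, i ∉ s → c i = 0} := by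
    ext c
    simp only [supportCone, mem_ofPred_eq, mem_iUnion, exists_prop]
    constructor
    · rintro ⟨h, s, hs, h'⟩
      exact ⟨s, hs, h, h'⟩
    · rintro ⟨s, hs, h, h'⟩
      exact ⟨h, s, hs, h'⟩
  rw [this]
  refine (toFinite 𝒦).isClosed_biUnion fun s _ => ?_
  simp only [ofPred_and, ofPred_forall]
  refine IsClosed.inter (isClosed_iInter fun i => ?_)
    (isClosed_iInter fun i => isClosed_iInter fun _ => ?_)
  · exact isClosed_le continuous_const (continuous_apply i)
  · exact isClosed_eq (continuous_apply i) continuous_const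

end Model

/-! ### Rescaling homeomorphisms of a coordinate fan -/

section Rescaling

theorem norm_div_norm_smul_le {V : Type*} [NormedAddCommGroup V] [NormedSpace ℝ V] (a : ℝ) (v : V) :
    ‖(a / ‖v‖) • v‖ ≤ |a| := by
  rcases eq_or_ne v 0 with rfl | hv
  · simp
  · rw [norm_smul, norm_div, norm_norm, div_mul_cancel₀ _ (norm_ne_zero_iff.2 hv), Real.norm_eq_abs]

theorem norm_div_norm_smul {V : Type*} [NormedAddCommGroup V] [NormedSpace ℝ V] {a : ℝ} {v : V}
    (ha : 0 ≤ a) (h : v = 0 → a = 0) : ‖(a / ‖v‖) • v‖ = a := by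
  rcases eq_or_ne v 0 with rfl | hv
  · simp [h rfl]
  · rw [norm_smul, norm_div, norm_norm, div_mul_cancel₀ _ (norm_ne_zero_iff.2 hv),
      Real.norm_of_nonneg ha]

theorem continuousOn_div_norm_smul {X V : Type*} [TopologicalSpace X] [NormedAddCommGroup V]
    [NormedSpace ℝ V] {K : Set X} {a : X → ℝ} {g : X → V} (ha : ContinuousOn a K)
    (hg : ContinuousOn g K) (h : ∀ x ∈ K, g x = 0 → a x = 0) :
    ContinuousOn (fun x => (a x / ‖g x‖) • g x) K := by
  intro x hx
  by_cases h0 : g x = 0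
  · -- the norm of the rescaled vector is at most `|a|`, and this tends to zero
    have h1 : Tendsto (fun y => |a y|) (𝓝[K] x) (𝓝 0) := by
      have := (ha x hx).abs
      rwa [ContinuousWithinAt, h x hx h0, abs_zero] at this
    rw [ContinuousWithinAt, h0, smul_zero]
    exact squeeze_zero_norm (fun y => norm_div_norm_smul_le _ _) h1
  · exact ((ha x hx).div (hg x hx).norm (norm_ne_zero_iff.2 h0)).smul (hg x hx)

variable {ι : Type*}

theorem indicator_compl_add_smul_indicator (S : Set ι) (c : ι → ℝ) (t : ℝ) :
    Sᶜ.indicator (Sᶜ.indicator c + t • S.indicator c) = Sᶜ.indicator c ∧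
      S.indicator (Sᶜ.indicator c + t • S.indicator c) = t • S.indicator c := by
  constructor <;> ext i <;> by_cases hi : i ∈ S <;> simp [hi]

theorem continuous_indicator_pi (S : Set ι) : Continuous fun c : ι → ℝ => S.indicator c := by
  refine continuous_pi fun i => ?_
  by_cases hi : i ∈ S
  · simpa [hi] using continuous_apply i
  · simpa [hi] using continuous_const

theorem indicator_add_smul_mem_supportCone {𝒦 : Set (Finset ι)} {c : ι → ℝ}
    (hc : c ∈ supportCone 𝒦) (S : Set ι) {t : ℝ} (ht : 0 ≤ t) :
    Sᶜ.indicator c + t • S.indicator c ∈ supportCone 𝒦 := by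
  obtain ⟨h0, s, hs, hsc⟩ := hc
  refine ⟨fun i => ?_, s, hs, fun i hi => ?_⟩
  · by_cases hi : i ∈ S
    · simpa [hi] using mul_nonneg ht (h0 i)
    · simpa [hi] using h0 i
  · by_cases hi' : i ∈ S <;> simp [hi', hsc i hi]

theorem indicator_mem_supportCone {𝒦 : Set (Finset ι)} {c : ι → ℝ}
    (hc : c ∈ supportCone 𝒦) (S : Set ι) : S.indicator c ∈ supportCone 𝒦 := by
  simpa using indicator_add_smul_mem_supportCone hc Sᶜ le_rfl

variable [Fintype ι]

/-- Rescale the coordinates in `S` by a common factor so that their sup norm becomes `l c`. Nothing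
is changed where these coordinates vanish; the quotient by zero is harmless there. -/
def rescalePart (S : Set ι) (l : (ι → ℝ) → ℝ) (c : ι → ℝ) : ι → ℝ :=
  Sᶜ.indicator c + (l c / ‖S.indicator c‖) • S.indicator c

theorem indicator_rescalePart (S : Set ι) (l : (ι → ℝ) → ℝ) (c : ι → ℝ) :
    S.indicator (rescalePart S l c) = (l c / ‖S.indicator c‖) • S.indicator c := by
  ext i
  by_cases hi : i ∈ S <;> simp [rescalePart, hi]

theorem indicator_compl_rescalePart (S : Set ι) (l : (ι → ℝ) → ℝ) (c : ι → ℝ) :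
    Sᶜ.indicator (rescalePart S l c) = Sᶜ.indicator c := by
  ext i
  by_cases hi : i ∈ S <;> simp [rescalePart, hi]

theorem continuous_rescalePart (S : Set ι) {l : (ι → ℝ) → ℝ} (hl : Continuous l)
    (hl0 : ∀ c, S.indicator c = 0 → l c = 0) : Continuous (rescalePart S l) := by
  rw [← continuousOn_univ]
  exact (continuous_indicator_pi _).continuousOn.add (continuousOn_div_norm_smul hl.continuousOn
    (continuous_indicator_pi _).continuousOn fun c _ => hl0 c)

/-- If the prescribed size `l` vanishes when the coordinates in `S` do, and grows at least linearly
when these coordinates are scaled up, then `rescalePart S l` permutes the coordinate fan and the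
coordinates in `S` of the image have sup norm `l c`. -/
theorem bijOn_rescalePart {𝒦 : Set (Finset ι)} (S : Set ι) {l : (ι → ℝ) → ℝ} (hl : Continuous l)
    (hl0 : ∀ c, S.indicator c = 0 → l c = 0)
    (hmono : ∀ c ∈ supportCone 𝒦, S.indicator c ≠ 0 → ∃ k > 0, ∀ t t' : ℝ, 0 ≤ t → t ≤ t' →
      k * (t' - t) ≤ l (Sᶜ.indicator c + t' • S.indicator c) -
        l (Sᶜ.indicator c + t • S.indicator c)) :
    BijOn (rescalePart S l) (supportCone 𝒦) (supportCone 𝒦) ∧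
      ∀ c ∈ supportCone 𝒦, ‖S.indicator (rescalePart S l c)‖ = l c := by
  have hdec : ∀ c : ι → ℝ, Sᶜ.indicator c + (1 : ℝ) • S.indicator c = c := fun c => by
    rw [one_smul, indicator_compl_add_self]
  have hlzero : ∀ c : ι → ℝ, l (Sᶜ.indicator c + (0 : ℝ) • S.indicator c) = 0 := fun c => by
    refine hl0 _ ?_
    rw [(indicator_compl_add_smul_indicator S c 0).2, zero_smul]
  have hpos : ∀ c ∈ supportCone 𝒦, S.indicator c ≠ 0 → 0 < l c := fun c hc h => by
    obtain ⟨k, hk, H⟩ := hmono c hc h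
    have := H 0 1 le_rfl zero_le_one
    rw [hdec, hlzero] at this
    linarith
  have hnn : ∀ c ∈ supportCone 𝒦, 0 ≤ l c := fun c hc => by
    by_cases h : S.indicator c = 0
    exacts [(hl0 c h).ge, (hpos c hc h).le]
  have hnorm : ∀ c ∈ supportCone 𝒦, ‖S.indicator (rescalePart S l c)‖ = l c := fun c hc => by
    rw [indicator_rescalePart]
    exact norm_div_norm_smul (hnn c hc) (hl0 c)
  refine ⟨⟨fun c hc => indicator_add_smul_mem_supportCone hc S
    (div_nonneg (hnn c hc) (norm_nonneg _)), fun c hc d hd h => ?_, fun d hd => ?_⟩, hnorm⟩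
  · have h1 : Sᶜ.indicator c = Sᶜ.indicator d := by
      rw [← indicator_compl_rescalePart S l c, h, indicator_compl_rescalePart]
    have h2 : l c = l d := by rw [← hnorm c hc, h, hnorm d hd]
    have h3 := congrArg S.indicator h
    rw [indicator_rescalePart, indicator_rescalePart] at h3
    by_cases hc0 : S.indicator c = 0
    · have hd0 : S.indicator d = 0 := by
        by_contra hd0
        have := hpos d hd hd0
        rw [← h2, hl0 c hc0] at this
        exact lt_irrefl _ this
      rw [← hdec c, ← hdec d, h1, hc0, hd0]
    · have hlc := hpos c hc hc0
      have hd0 : S.indicator d ≠ 0 := fun hd0 => by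
        rw [h2, hl0 d hd0] at hlc
        exact lt_irrefl _ hlc
      obtain ⟨k, hk, H⟩ := hmono c hc hc0
      -- the two points lie on the same ray, where `l` is strictly increasing
      obtain ⟨t, ht, htd⟩ : ∃ t : ℝ, 0 < t ∧ S.indicator d = t • S.indicator c := by
        refine ⟨‖S.indicator d‖ / ‖S.indicator c‖, by positivity, ?_⟩
        rw [← h2] at h3
        have h4 := congrArg (fun z => (‖S.indicator d‖ / l c) • z) h3
        simp only [smul_smul] at h4
        rw [show ‖S.indicator d‖ / l c * (l c / ‖S.indicator d‖) = 1 by field_simp, one_smul] at h4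
        refine h4.symm.trans ?_
        congr 1
        field_simp
      have hd' : Sᶜ.indicator c + t • S.indicator c = d := by
        rw [← htd, h1, indicator_compl_add_self]
      have ht1 : t = 1 := by
        rcases le_total t 1 with h | h
        · have := H t 1 ht.le h
          rw [hdec, hd', h2] at this
          nlinarith
        · have := H 1 t zero_le_one h
          rw [hdec, hd', h2] at this
          nlinarith
      rw [← hd', ht1, hdec]
  · by_cases hd0 : S.indicator d = 0
    · refine ⟨d, hd, ?_⟩
      rw [rescalePart, hd0, smul_zero, add_zero]
      have := indicator_compl_add_self S d
      rwa [hd0, add_zero] at this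
    · obtain ⟨k, hk, H⟩ := hmono d hd hd0
      have hx : 0 < ‖S.indicator d‖ := norm_pos_iff.2 hd0
      have hT : 0 ≤ ‖S.indicator d‖ / k := by positivity
      have hcont : ContinuousOn (fun t : ℝ => l (Sᶜ.indicator d + t • S.indicator d))
          (Icc 0 (‖S.indicator d‖ / k)) := by
        refine (hl.comp ?_).continuousOn
        fun_prop
      obtain ⟨t, ht, htl⟩ := intermediate_value_Icc hT hcont (show ‖S.indicator d‖ ∈ _ from by
        refine ⟨(hlzero d).le.trans hx.le, ?_⟩
        have := H 0 _ le_rfl hT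
        rw [hlzero, sub_zero, sub_zero, mul_div_cancel₀ _ hk.ne'] at this
        exact this)
      dsimp only at htl
      have ht0 : 0 < t := by
        refine lt_of_le_of_ne ht.1 fun h0 => ?_
        rw [← h0, hlzero] at htl
        exact hx.ne htl
      refine ⟨_, indicator_add_smul_mem_supportCone hd S ht.1, ?_⟩
      rw [rescalePart, (indicator_compl_add_smul_indicator S d t).1,
        (indicator_compl_add_smul_indicator S d t).2, htl, smul_smul, norm_smul,
        Real.norm_of_nonneg ht0.le,
        show ‖S.indicator d‖ / (t * ‖S.indicator d‖) * t = 1 by field_simp, one_smul,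
        indicator_compl_add_self]

theorem rescalePart_smul (S : Set ι) {l : (ι → ℝ) → ℝ} {t : ℝ} (ht : 0 < t) (c : ι → ℝ)
    (hl : l (t • c) = t * l c) : rescalePart S l (t • c) = t • rescalePart S l c := by
  have h : ∀ S : Set ι, S.indicator (t • c) = t • S.indicator c := fun S => by
    ext i
    by_cases hi : i ∈ S <;> simp [hi]
  rw [rescalePart, rescalePart, h, h, hl, norm_smul, Real.norm_of_nonneg ht.le,
    mul_div_mul_left _ _ ht.ne', smul_add, smul_comm t]

/-- Radial rescaling: a positively homogeneous bijection of a coordinate fan can be changed along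
rays so that it turns a given gauge `N` into the sup norm. -/
theorem bijOn_div_norm_smul {𝒦 : Set (Finset ι)} {Ψ : (ι → ℝ) → ι → ℝ} {N : (ι → ℝ) → ℝ}
    (hΨ : BijOn Ψ (supportCone 𝒦) (supportCone 𝒦)) (hΨ0 : Ψ 0 = 0)
    (hΨs : ∀ c ∈ supportCone 𝒦, ∀ t : ℝ, 0 < t → Ψ (t • c) = t • Ψ c)
    (hNs : ∀ c ∈ supportCone 𝒦, ∀ t : ℝ, 0 < t → N (t • c) = t * N c) (hN0 : N 0 = 0)
    (hN : ∀ c ∈ supportCone 𝒦, c ≠ 0 → 0 < N c) :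
    BijOn (fun c => (N c / ‖Ψ c‖) • Ψ c) (supportCone 𝒦) (supportCone 𝒦) ∧
      ∀ c ∈ supportCone 𝒦, ‖(N c / ‖Ψ c‖) • Ψ c‖ = N c := by
  have hnn : ∀ c ∈ supportCone 𝒦, 0 ≤ N c := fun c hc => by
    by_cases h : c = 0
    exacts [h ▸ hN0.ge, (hN c hc h).le]
  have hz : ∀ c ∈ supportCone 𝒦, Ψ c = 0 → c = 0 := fun c hc h => by
    refine hΨ.injOn hc ?_ (h.trans hΨ0.symm)
    simpa using smul_mem_supportCone hc le_rfl
  have hnorm : ∀ c ∈ supportCone 𝒦, ‖(N c / ‖Ψ c‖) • Ψ c‖ = N c := fun c hc =>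
    norm_div_norm_smul (hnn c hc) fun h => by rw [hz c hc h, hN0]
  refine ⟨⟨fun c hc => smul_mem_supportCone (hΨ.mapsTo hc) (div_nonneg (hnn c hc) (norm_nonneg _)),
    fun c hc d hd h => ?_, fun d hd => ?_⟩, hnorm⟩
  · dsimp only at h
    have h2 : N c = N d := by rw [← hnorm c hc, h, hnorm d hd]
    by_cases hc0 : c = 0
    · by_contra hne
      have := hN d hd (fun h => hne (hc0.trans h.symm))
      rw [← h2, hc0, hN0] at this
      exact lt_irrefl _ this
    · have hNc := hN c hc hc0
      have hd0 : d ≠ 0 := fun h => by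
        rw [h2, h, hN0] at hNc
        exact lt_irrefl _ hNc
      have hΨc : 0 < ‖Ψ c‖ := norm_pos_iff.2 fun h => hc0 (hz c hc h)
      have hΨd : 0 < ‖Ψ d‖ := norm_pos_iff.2 fun h => hd0 (hz d hd h)
      have ht : 0 < ‖Ψ d‖ / ‖Ψ c‖ := by positivity
      have hdc : d = (‖Ψ d‖ / ‖Ψ c‖) • c := by
        refine hΨ.injOn hd (smul_mem_supportCone hc ht.le) ?_
        rw [hΨs c hc _ ht]
        have h4 := congrArg (fun z => (‖Ψ d‖ / N d) • z) h
        simp only [smul_smul] at h4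
        rw [← h2, show ‖Ψ d‖ / N c * (N c / ‖Ψ d‖) = 1 by field_simp, one_smul] at h4
        refine h4.symm.trans ?_
        congr 1
        field_simp
      have h5 : N d = ‖Ψ d‖ / ‖Ψ c‖ * N c := by
        conv_lhs => rw [hdc]
        exact hNs c hc _ ht
      have h6 : ‖Ψ d‖ / ‖Ψ c‖ = 1 := by
        rw [← h2] at h5
        exact (mul_eq_right₀ hNc.ne').1 h5.symm
      rw [hdc, h6, one_smul]
  · obtain ⟨c, hc, rfl⟩ := hΨ.surjOn hd
    by_cases hc0 : c = 0
    · exact ⟨0, hc0 ▸ hc, by simp [hc0, hΨ0]⟩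
    · have hNc := hN c hc hc0
      have hΨc : 0 < ‖Ψ c‖ := norm_pos_iff.2 fun h => hc0 (hz c hc h)
      have ht : 0 < ‖Ψ c‖ / N c := by positivity
      refine ⟨(‖Ψ c‖ / N c) • c, smul_mem_supportCone hc ht.le, ?_⟩
      dsimp only
      rw [hΨs c hc _ ht, hNs c hc _ ht, norm_smul, Real.norm_of_nonneg ht.le, smul_smul,
        show ‖Ψ c‖ / N c * N c / (‖Ψ c‖ / N c * ‖Ψ c‖) * (‖Ψ c‖ / N c) = 1 by field_simp, one_smul]

end Rescaling

/-! ### The index of a set that is locally a simplicial fan -/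

section Index

/-- A continuous bijection from a compact set onto a set in a Hausdorff space is a
homeomorphism. -/
theorem exists_homeomorph_of_bijOn {X Y : Type*} [TopologicalSpace X] [TopologicalSpace Y]
    [T2Space Y] {f : X → Y} {s : Set X} {t : Set Y} (hs : IsCompact s) (hf : ContinuousOn f s)
    (h : BijOn f s t) : ∃ e : s ≃ₜ t, ∀ x : s, (e x : Y) = f x := by
  have := isCompact_iff_compactSpace.1 hs
  have hc : Continuous (h.equiv f) := by
    refine Continuous.subtype_mk (continuousOn_iff_continuous_domRestrict.1 hf) _
  exact ⟨hc.homeoOfEquivCompactToT2, fun x => rfl⟩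

variable {ι : Type*} [Fintype ι] {E : Type*} [NormedAddCommGroup E] [InnerProductSpace ℝ E]

/-- An injective linear parametrization of a fan expands norms by at least a fixed factor. -/
theorem exists_pos_mul_norm_le {F : Type*} [NormedAddCommGroup F] [NormedSpace ℝ F]
    {𝒦 : Set (Finset ι)} (L : (ι → ℝ) →ₗ[ℝ] F)
    (hinj : InjOn L (supportCone 𝒦)) :
    ∃ k > 0, ∀ c ∈ supportCone 𝒦, k * ‖c‖ ≤ ‖L c‖ := by
  have hcomp : IsCompact (supportCone 𝒦 ∩ Metric.sphere 0 1) :=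
    (isCompact_sphere _ _).inter_left (isClosed_supportCone 𝒦)
  have hcont : Continuous L := L.continuous_of_finiteDimensional
  obtain ⟨k, hk, H⟩ : ∃ k > 0, ∀ c ∈ supportCone 𝒦 ∩ Metric.sphere 0 1, k ≤ ‖L c‖ := by
    rcases (supportCone 𝒦 ∩ Metric.sphere 0 1).eq_empty_or_nonempty with h | h
    · exact ⟨1, one_pos, by simp [h]⟩
    · obtain ⟨c, hc, hmin⟩ := hcomp.exists_isMinOn h hcont.norm.continuousOn
      refine ⟨‖L c‖, norm_pos_iff.2 fun h0 => ?_, fun d hd => hmin hd⟩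
      have : c = 0 := hinj hc.1 (by simpa using smul_mem_supportCone hc.1 le_rfl) (by simp [h0])
      simpa [this] using hc.2
  refine ⟨k, hk, fun c hc => ?_⟩
  rcases eq_or_ne c 0 with rfl | h0
  · simp
  · have hn : 0 < ‖c‖ := norm_pos_iff.2 h0
    have := H (‖c‖⁻¹ • c) ⟨smul_mem_supportCone hc (by positivity), by
      simp [norm_smul, hn.ne']⟩
    rw [map_smul, norm_smul, Real.norm_of_nonneg (by positivity), ← div_eq_inv_mul,
      le_div_iff₀ hn] at this
    exact this

/-- Let `w` parametrize a fan, let `S` be the set of generators of positive height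
`⟪w i, a⟫`, and let `e` be small. For every gauge `N` there is a permutation of the coordinate fan
that turns `N` into the sup norm and the region `e * ‖y‖ ≤ ⟪y, a⟫` into the region where the
largest coordinate belongs to `S`. -/
theorem exists_bijOn_supportCone {𝒦 : Set (Finset ι)} (h𝒦 : 𝒦.Nonempty) (w : ι → E)
    (hinj : InjOn (Fintype.linearCombination ℝ w) (supportCone 𝒦)) (a : E) {e : ℝ} (he : 0 < e)
    (hew : ∀ i, 0 < ⟪w i, a⟫_ℝ → e * ‖w i‖ < ⟪w i, a⟫_ℝ) {N : (ι → ℝ) → ℝ}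
    (hNc : Continuous N) (hNs : ∀ c, ∀ t : ℝ, 0 < t → N (t • c) = t * N c)
    (hN0 : N 0 = 0) (hN : ∀ c ∈ supportCone 𝒦, c ≠ 0 → 0 < N c) :
    ∃ H : (ι → ℝ) → ι → ℝ, ContinuousOn H (supportCone 𝒦) ∧
      BijOn H (supportCone 𝒦) (supportCone 𝒦) ∧ (∀ c ∈ supportCone 𝒦, ‖H c‖ = N c) ∧
      ∀ c ∈ supportCone 𝒦, c ≠ 0 →
        (‖{i | 0 < ⟪w i, a⟫_ℝ}ᶜ.indicator (H c)‖ ≤ ‖{i | 0 < ⟪w i, a⟫_ℝ}.indicator (H c)‖ ↔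
          e * ‖Fintype.linearCombination ℝ w c‖ ≤ ⟪Fintype.linearCombination ℝ w c, a⟫_ℝ) := by
  set S : Set ι := {i | 0 < ⟪w i, a⟫_ℝ} with hS
  set L : (ι → ℝ) →ₗ[ℝ] E := Fintype.linearCombination ℝ w with hL
  have hLc : Continuous L := L.continuous_of_finiteDimensional
  have hsplit : ∀ c : ι → ℝ, L c = L (Sᶜ.indicator c) + L (S.indicator c) := fun c => by
    rw [← map_add, indicator_compl_add_self]
  have hind : ∀ (S : Set ι) (c : ι → ℝ) (t : ℝ), S.indicator (t • c) = t • S.indicator c :=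
    fun S c t => by
      ext i
      by_cases hi : i ∈ S <;> simp [hi]
  have hLinner : ∀ c, ⟪L c, a⟫_ℝ = ∑ i, c i * ⟪w i, a⟫_ℝ := fun c => by
    rw [hL, Fintype.linearCombination_apply, sum_inner]
    simp [inner_smul_left]
  -- the new sizes of the two parts of `c`: each grows with its part, `Q` does not depend on the
  -- part in `S`, and for `y = L c` the difference `P - Q` is `⟪y, a⟫ - e * ‖y‖`
  let P : (ι → ℝ) → ℝ := fun c =>
    ⟪L (S.indicator c), a⟫_ℝ - e * (‖L c‖ - ‖L (Sᶜ.indicator c)‖)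
  let Q : (ι → ℝ) → ℝ := fun c => -⟪L (Sᶜ.indicator c), a⟫_ℝ + e * ‖L (Sᶜ.indicator c)‖
  have hPc : Continuous P := by
    have h1 := hLc.comp (continuous_indicator_pi S)
    have h2 := hLc.comp (continuous_indicator_pi Sᶜ)
    exact (h1.inner continuous_const).sub (continuous_const.mul (hLc.norm.sub h2.norm))
  have hQc : Continuous Q := by
    have h2 := hLc.comp (continuous_indicator_pi Sᶜ)
    exact (h2.inner continuous_const).neg.add (continuous_const.mul h2.norm)
  have hP0 : ∀ c, S.indicator c = 0 → P c = 0 := fun c h => by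
    simp [P, h, hsplit c]
  have hQ0 : ∀ c, Sᶜ.indicator c = 0 → Q c = 0 := fun c h => by
    simp [Q, h]
  have hPs : ∀ (c) (t : ℝ), 0 < t → P (t • c) = t * P c := fun c t ht => by
    simp only [P, hind, map_smul, norm_smul, inner_smul_left, Real.norm_of_nonneg ht.le]
    simp only [conj_trivial]
    ring
  have hQs : ∀ (c) (t : ℝ), 0 < t → Q (t • c) = t * Q c := fun c t ht => by
    simp only [Q, hind, map_smul, norm_smul, inner_smul_left, Real.norm_of_nonneg ht.le]
    simp only [conj_trivial]
    ring
  have hPm : ∀ c ∈ supportCone 𝒦, S.indicator c ≠ 0 → ∃ k > 0, ∀ t t' : ℝ, 0 ≤ t → t ≤ t' →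
      k * (t' - t) ≤ P (Sᶜ.indicator c + t' • S.indicator c) -
        P (Sᶜ.indicator c + t • S.indicator c) := by
    intro c hc hc0
    refine ⟨⟪L (S.indicator c), a⟫_ℝ - e * ‖L (S.indicator c)‖, ?_, fun t t' _ htt' => ?_⟩
    · have h1 : e * ‖L (S.indicator c)‖ ≤ ∑ i, S.indicator c i * (e * ‖w i‖) := by
        rw [hL, Fintype.linearCombination_apply]
        refine (mul_le_mul_of_nonneg_left (norm_sum_le _ _) he.le).trans ?_
        rw [Finset.mul_sum]
        refine Finset.sum_le_sum fun i _ => ?_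
        rw [norm_smul, Real.norm_of_nonneg ((indicator_mem_supportCone hc S).1 i)]
        exact (mul_left_comm _ _ _).le
      obtain ⟨j, hj⟩ := Function.ne_iff.1 hc0
      have hjS : j ∈ S := by
        by_contra h
        simp [h] at hj
      have h2 : ∑ i, S.indicator c i * (e * ‖w i‖) < ∑ i, S.indicator c i * ⟪w i, a⟫_ℝ := by
        refine Finset.sum_lt_sum (fun i _ => ?_) ⟨j, Finset.mem_univ _, ?_⟩
        · by_cases hi : i ∈ S
          · exact mul_le_mul_of_nonneg_left (hew i hi).le ((indicator_mem_supportCone hc S).1 i)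
          · simp [hi]
        · exact mul_lt_mul_of_pos_left (hew j hjS)
            (((indicator_mem_supportCone hc S).1 j).lt_of_ne' hj)
      rw [hLinner]
      linarith
    · have h3 : ‖L (Sᶜ.indicator c) + t' • L (S.indicator c)‖ ≤
          ‖L (Sᶜ.indicator c) + t • L (S.indicator c)‖ + (t' - t) * ‖L (S.indicator c)‖ := by
        have : L (Sᶜ.indicator c) + t' • L (S.indicator c) =
          (L (Sᶜ.indicator c) + t • L (S.indicator c)) + (t' - t) • L (S.indicator c) := by module
        rw [this]
        refine (norm_add_le _ _).trans ?_
        rw [norm_smul, Real.norm_of_nonneg (sub_nonneg.2 htt')]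
      simp only [P, indicator_compl_add_smul_indicator, map_add, map_smul, inner_smul_left]
      simp only [conj_trivial]
      nlinarith [mul_le_mul_of_nonneg_left h3 he.le]
  have hLpos : ∀ c ∈ supportCone 𝒦, c ≠ 0 → 0 < ‖L c‖ := fun c hc h => by
    refine norm_pos_iff.2 fun h0 => h (hinj hc (zero_mem_supportCone h𝒦) ?_)
    rw [h0, map_zero]
  have hQm : ∀ c ∈ supportCone 𝒦, Sᶜ.indicator c ≠ 0 → ∃ k > 0, ∀ t t' : ℝ, 0 ≤ t → t ≤ t' →
      k * (t' - t) ≤ Q (Sᶜᶜ.indicator c + t' • Sᶜ.indicator c) -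
        Q (Sᶜᶜ.indicator c + t • Sᶜ.indicator c) := by
    intro c hc hc0
    refine ⟨-⟪L (Sᶜ.indicator c), a⟫_ℝ + e * ‖L (Sᶜ.indicator c)‖, ?_, fun t t' ht htt' => ?_⟩
    · have h1 := mul_pos he (hLpos _ (indicator_mem_supportCone hc Sᶜ) hc0)
      have h2 : ⟪L (Sᶜ.indicator c), a⟫_ℝ ≤ 0 := by
        rw [hLinner]
        refine Finset.sum_nonpos fun i _ => ?_
        by_cases hi : i ∈ S
        · simp [hi]
        · exact mul_nonpos_of_nonneg_of_nonpos ((indicator_mem_supportCone hc Sᶜ).1 i) (not_lt.1 hi)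
      linarith
    · simp only [Q, indicator_compl_add_smul_indicator, map_smul, inner_smul_left, norm_smul,
        Real.norm_of_nonneg ht, Real.norm_of_nonneg (ht.trans htt')]
      simp only [conj_trivial]
      linarith
  obtain ⟨hPb, hPn⟩ := bijOn_rescalePart S hPc hP0 hPm
  obtain ⟨hQb, hQn⟩ := bijOn_rescalePart Sᶜ hQc hQ0 hQm
  let Ψ : (ι → ℝ) → ι → ℝ := rescalePart Sᶜ Q ∘ rescalePart S P
  have hΨ : BijOn Ψ (supportCone 𝒦) (supportCone 𝒦) := hQb.comp hPb
  have hΨc : Continuous Ψ :=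
    (continuous_rescalePart _ hQc hQ0).comp (continuous_rescalePart _ hPc hP0)
  have hΨ0 : Ψ 0 = 0 := by
    have h : ∀ (S : Set ι) (l : (ι → ℝ) → ℝ), rescalePart S l 0 = 0 := fun S l => by
      simp [rescalePart]
    simp only [Ψ, Function.comp_apply, h]
  have hΨs : ∀ c ∈ supportCone 𝒦, ∀ t : ℝ, 0 < t → Ψ (t • c) = t • Ψ c := fun c _ t ht => by
    simp only [Ψ, Function.comp_apply]
    rw [rescalePart_smul S ht c (hPs c t ht), rescalePart_smul Sᶜ ht _ (hQs _ t ht)]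
  obtain ⟨hHb, hHn⟩ := bijOn_div_norm_smul hΨ hΨ0 hΨs (fun c _ => hNs c) hN0 hN
  refine ⟨_, continuousOn_div_norm_smul hNc.continuousOn hΨc.continuousOn fun c hc h => ?_,
    hHb, hHn, fun c hc hc0 => ?_⟩
  · rw [hΨ.injOn hc (zero_mem_supportCone h𝒦) (h.trans hΨ0.symm), hN0]
  · have ht : 0 < N c / ‖Ψ c‖ := by
      refine div_pos (hN c hc hc0) (norm_pos_iff.2 fun h => hc0 ?_)
      exact hΨ.injOn hc (zero_mem_supportCone h𝒦) (h.trans hΨ0.symm)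
    have h1 : ‖S.indicator (Ψ c)‖ = P c := by
      have := indicator_compl_rescalePart Sᶜ Q (rescalePart S P c)
      rw [compl_compl] at this
      rw [← hPn c hc, ← this]
      rfl
    have h2 : ‖Sᶜ.indicator (Ψ c)‖ = Q c := by
      refine (hQn _ (hPb.mapsTo hc)).trans ?_
      simp only [Q, indicator_compl_rescalePart]
    rw [hind, hind, norm_smul, norm_smul, Real.norm_of_nonneg ht.le, mul_le_mul_iff_right₀ ht,
      h1, h2]
    have h3 : P c - Q c = ⟪L c, a⟫_ℝ - e * ‖L c‖ := by
      have h4 : ⟪L c, a⟫_ℝ = ⟪L (Sᶜ.indicator c), a⟫_ℝ + ⟪L (S.indicator c), a⟫_ℝ := by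
        rw [hsplit c, inner_add_left]
      simp only [P, Q]
      linarith
    constructor <;> intro h <;> linarith

end Index

section IndexOfFan

variable {ι : Type u} [Fintype ι] {E : Type u} [NormedAddCommGroup E] [InnerProductSpace ℝ E]

/-- The set `X` is near `x` the translate to `x` of the simplicial fan with generators `w` and
cones indexed by `𝒦`; the fan is simplicial in the sense that its points have unique nonnegative
coefficients. -/
def IsFanAt (𝒦 : Set (Finset ι)) (w : ι → E) (X : Set E) (x : E) : Prop :=
  InjOn (Fintype.linearCombination ℝ w) (supportCone 𝒦) ∧
    ∃ r > 0, ∀ y, ‖y - x‖ ≤ r →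
      (y ∈ X ↔ y - x ∈ Fintype.linearCombination ℝ w '' supportCone 𝒦)

/-- The index of a set that is locally a simplicial fan only depends on the combinatorics of the
fan and on the set of generators of positive height. -/
theorem IsFanAt.isIndex {𝒦 : Set (Finset ι)} (h𝒦 : 𝒦.Nonempty) {w : ι → E} {X : Set E} {x : E}
    (h : IsFanAt 𝒦 w X x) (ρ : CurvatureMap.{u}) (a : E) :
    ρ.IsIndex X x a (ρ.modelValue 𝒦 {i | 0 < ⟪w i, a⟫_ℝ}) := by
  obtain ⟨hinj, r₀, hr₀, hX⟩ := h
  set S : Set ι := {i | 0 < ⟪w i, a⟫_ℝ} with hS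
  set L : (ι → ℝ) →ₗ[ℝ] E := Fintype.linearCombination ℝ w with hL
  have hLc : Continuous L := L.continuous_of_finiteDimensional
  filter_upwards [Ioc_mem_nhdsGT hr₀] with r hr
  have hr0 := hr.1
  have hsmall : ∀ i, ∀ᶠ δ in 𝓝[>] (0 : ℝ), 0 < ⟪w i, a⟫_ℝ → δ / r * ‖w i‖ < ⟪w i, a⟫_ℝ := by
    intro i
    by_cases hi : 0 < ⟪w i, a⟫_ℝ
    · have hc : Tendsto (fun δ : ℝ => δ / r * ‖w i‖) (𝓝[>] 0) (𝓝 0) := by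
        have : Continuous fun δ : ℝ => δ / r * ‖w i‖ := by fun_prop
        simpa using (this.tendsto 0).mono_left nhdsWithin_le_nhds
      filter_upwards [hc.eventually_lt_const hi] with δ hδ _ using hδ
    · exact Eventually.of_forall fun _ h => absurd h hi
  filter_upwards [eventually_all.2 hsmall, self_mem_nhdsWithin] with δ hew hδ
  rw [mem_Ioi] at hδ
  -- the gauge of the intersection of the ball and the slab that define the cone of `X`
  let N : (ι → ℝ) → ℝ := fun c => max (‖L c‖ / r) (|⟪L c, a⟫_ℝ| / δ)
  have hNc : Continuous N := by
    have := hLc.inner (𝕜 := ℝ) (continuous_const (y := a))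
    exact (hLc.norm.div_const _).max (this.abs.div_const _)
  have hNs : ∀ c, ∀ t : ℝ, 0 < t → N (t • c) = t * N c := fun c t ht => by
    simp only [N, map_smul, norm_smul, inner_smul_left, Real.norm_of_nonneg ht.le, abs_mul,
      conj_trivial, abs_of_pos ht, mul_div_assoc]
    rw [mul_max_of_nonneg _ _ ht.le]
  have hN0 : N 0 = 0 := by simp [N]
  have hN : ∀ c ∈ supportCone 𝒦, c ≠ 0 → 0 < N c := fun c hc h => by
    refine lt_max_of_lt_left (div_pos (norm_pos_iff.2 fun h0 => h ?_) hr0)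
    exact hinj hc (zero_mem_supportCone h𝒦) (h0.trans (map_zero L).symm)
  obtain ⟨H, hHc, hHb, hHn, hHS⟩ :=
    exists_bijOn_supportCone h𝒦 w hinj a (div_pos hδ hr0) hew hNc hNs hN0 hN
  -- the compact coordinate domain that is compared both with the model and with the cone of `X`
  let D : Set (ι → ℝ) := {c | c ∈ supportCone 𝒦 ∧ N c ≤ 1}
  have hDK : D ⊆ supportCone 𝒦 := fun c hc => hc.1
  have hD : ∀ c, c ∈ supportCone 𝒦 → (c ∈ D ↔ ‖L c‖ ≤ r ∧ -δ ≤ ⟪L c, a⟫_ℝ ∧ ⟪L c, a⟫_ℝ ≤ δ) := by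
    intro c hc
    rw [← abs_le]
    simp only [D, N, mem_ofPred_eq, hc, true_and, max_le_iff, div_le_one hr0, div_le_one hδ]
  have hDcomp : IsCompact D := by
    obtain ⟨k, hk, hkL⟩ := exists_pos_mul_norm_le L hinj
    refine (isCompact_closedBall (0 : ι → ℝ) (r / k)).of_isClosed_subset
      ((isClosed_supportCone 𝒦).inter (isClosed_le hNc continuous_const)) fun c hc => ?_
    rw [mem_closedBall_zero_iff, le_div_iff₀ hk, mul_comm]
    exact (hkL c hc.1).trans ((hD c hc.1).1 hc).1
  have hcube : ∀ c, c ∈ supportCone 𝒦 → (c ∈ supportCube 𝒦 ↔ ‖c‖ ≤ 1) := by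
    intro c hc
    rw [pi_norm_le_iff_of_nonneg zero_le_one]
    simp only [supportCube, mem_ofPred_eq, hc, true_and, Real.norm_of_nonneg (hc.1 _)]
  have hb1 : BijOn H D (supportCube 𝒦) := by
    refine ⟨fun c hc => ?_, hHb.injOn.mono hDK, fun d hd => ?_⟩
    · rw [hcube _ (hHb.mapsTo hc.1), hHn c hc.1]
      exact hc.2
    · obtain ⟨c, hc, rfl⟩ := hHb.surjOn hd.1
      refine ⟨c, ⟨hc, ?_⟩, rfl⟩
      rw [← hHn c hc]
      exact (hcube _ hd.1).1 hd
  have hb2 : BijOn (fun c => x + L c) D (dirCone X x a r δ) := by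
    refine ⟨fun c hc => ?_, fun c hc d hd h => hinj hc.1 hd.1 (add_left_cancel h), fun y hy => ?_⟩
    · obtain ⟨h1, h2⟩ := (hD c hc.1).1 hc
      refine ⟨⟨?_, ?_⟩, ?_⟩
      · rw [hX _ (by simpa using h1.trans hr.2)]
        exact ⟨c, hc.1, by simp⟩
      · simpa [mem_closedBall_iff_norm] using h1
      · simpa using h2
    · have h1 : ‖y - x‖ ≤ r := mem_closedBall_iff_norm.1 hy.1.2
      obtain ⟨c, hc, hcy⟩ := (hX y (h1.trans hr.2)).1 hy.1.1
      refine ⟨c, (hD c hc).2 ?_, ?_⟩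
      · rw [hcy]
        exact ⟨h1, hy.2⟩
      · simp [hcy]
  obtain ⟨e₁, he₁⟩ := exists_homeomorph_of_bijOn hDcomp (hHc.mono hDK) hb1
  obtain ⟨e₂, he₂⟩ := exists_homeomorph_of_bijOn hDcomp (continuous_const.add hLc).continuousOn hb2
  have he₂' : ∀ c : D, (e₂ c : E) - x = L c := fun c => (congrArg (· - x) (he₂ c)).trans (by simp)
  have hface : ∀ c : D, (e₁ c : ι → ℝ) ∈ supportCubeFace 𝒦 S ↔ (e₂ c : E) ∈ dirLink X x a r δ := by
    intro c
    have hlink : (e₂ c : E) ∈ dirLink X x a r δ ↔ ⟪L c, a⟫_ℝ = δ := by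
      have h1 : (e₂ c : E) ∈ X ∩ Metric.closedBall x r := (e₂ c).2.1
      rw [dirLink, mem_ofPred_eq, he₂' c]
      exact and_iff_right h1
    have hmem : H c ∈ supportCone 𝒦 := hHb.mapsTo c.2.1
    have hHc1 : ‖H c‖ ≤ 1 := (hHn c c.2.1).trans_le c.2.2
    have hcoord : (e₁ c : ι → ℝ) ∈ supportCubeFace 𝒦 S ↔ ‖S.indicator (H c)‖ = 1 := by
      have h1 : (e₁ c : ι → ℝ) ∈ supportCube 𝒦 := (e₁ c).2
      rw [supportCubeFace, mem_ofPred_eq, and_iff_right h1, he₁ c]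
      have h2 : ∀ i ∈ S, ‖S.indicator (H c) i‖ = H c i := fun i hi => by
        rw [indicator_of_mem hi, Real.norm_of_nonneg (hmem.1 i)]
      constructor
      · rintro ⟨i, hi, hi1⟩
        refine le_antisymm ?_ ?_
        · refine (pi_norm_le_iff_of_nonneg zero_le_one).2 fun j => ?_
          refine (norm_indicator_le_norm_self (H c) j).trans ((norm_le_pi_norm _ _).trans hHc1)
        · rw [← hi1, ← h2 i hi]
          exact norm_le_pi_norm _ _
      · intro h3
        have hne : S.indicator (H c) ≠ 0 := fun h => by simp [h] at h3
        obtain ⟨j₀, hj₀⟩ := Function.ne_iff.1 hne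
        obtain ⟨j, -, hj⟩ := Finset.exists_max_image Finset.univ
          (fun i => ‖S.indicator (H c) i‖) ⟨j₀, Finset.mem_univ _⟩
        have h4 : ‖S.indicator (H c) j‖ = 1 := by
          refine le_antisymm ((norm_le_pi_norm _ _).trans h3.le) ?_
          rw [← h3]
          exact (pi_norm_le_iff_of_nonneg (norm_nonneg _)).2 fun i => hj i (Finset.mem_univ _)
        have hjS : j ∈ S := by
          by_contra h
          simp [h] at h4
        exact ⟨j, hjS, (h2 j hjS).symm.trans h4⟩
    have hmax : ‖H c‖ ≤ max (‖S.indicator (H c)‖) (‖Sᶜ.indicator (H c)‖) := by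
      refine (pi_norm_le_iff_of_nonneg (le_max_of_le_left (norm_nonneg _))).2 fun i => ?_
      by_cases hi : i ∈ S
      · refine le_max_of_le_left ?_
        simpa [hi] using norm_le_pi_norm (S.indicator (H c)) i
      · refine le_max_of_le_right ?_
        simpa [hi] using norm_le_pi_norm (Sᶜ.indicator (H c)) i
    have hle : ∀ S : Set ι, ‖S.indicator (H c)‖ ≤ ‖H c‖ := fun S =>
      (pi_norm_le_iff_of_nonneg (norm_nonneg _)).2 fun j =>
        (norm_indicator_le_norm_self (H c) j).trans (norm_le_pi_norm _ _)
    rw [hlink, hcoord]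
    have hNge : |⟪L c, a⟫_ℝ| / δ ≤ N c := le_max_right _ _
    have hNge' : ‖L c‖ / r ≤ N c := le_max_left _ _
    rcases eq_or_ne (c : ι → ℝ) 0 with h0 | h0
    · have h1 : H c = 0 := norm_eq_zero.1 (by rw [hHn c c.2.1, h0, hN0])
      rw [h1, h0]
      simp [hδ.ne]
    have hiff := hHS c c.2.1 h0
    constructor
    · intro h1
      have hN1 : N c = 1 := by
        refine le_antisymm c.2.2 ?_
        rw [← hHn c c.2.1, ← h1]
        exact hle S
      have h2 : δ / r * ‖L c‖ ≤ ⟪L c, a⟫_ℝ := hiff.1 (by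
        rw [h1]
        exact (hle _).trans hHc1)
      have h3 : 0 ≤ ⟪L c, a⟫_ℝ := le_trans (by positivity) h2
      -- on this region the gauge `N` equals `⟪y, a⟫ / δ`
      have h4 : N c = ⟪L c, a⟫_ℝ / δ := by
        simp only [N, abs_of_nonneg h3]
        refine max_eq_right ?_
        rw [le_div_iff₀ hδ]
        calc ‖L c‖ / r * δ = δ / r * ‖L c‖ := by ring
          _ ≤ _ := h2
      rw [h4, div_eq_one_iff_eq hδ.ne'] at hN1
      exact hN1
    · intro h1
      have hN1 : N c = 1 := by
        refine le_antisymm c.2.2 ?_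
        rw [h1, abs_of_pos hδ, div_self hδ.ne'] at hNge
        exact hNge
      have h2 : δ / r * ‖L c‖ ≤ ⟪L c, a⟫_ℝ := by
        rw [hN1] at hNge'
        rw [h1]
        calc δ / r * ‖L c‖ = δ * (‖L c‖ / r) := by ring
          _ ≤ δ * 1 := mul_le_mul_of_nonneg_left hNge' hδ.le
          _ = δ := mul_one δ
      have h3 := hiff.2 h2
      rw [max_eq_left h3, hHn c c.2.1, hN1] at hmax
      exact le_antisymm ((hle S).trans hHc1) hmax
  rw [CurvatureMap.modelValue, ← ρ.val_homeo _ _ _ (e₁.symm.trans e₂) (isPLPair_supportCube 𝒦 S)]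
  congr 1
  rw [← Homeomorph.preimage_symm]
  ext y
  obtain ⟨c, rfl⟩ := e₂.surjective y
  simp only [mem_preimage, Homeomorph.symm_trans_apply, Homeomorph.symm_symm,
    Homeomorph.symm_apply_apply]
  exact (hface c).symm

end IndexOfFan

/-! ### Simplicial complexes near an interior point of a face -/

section Barycentric

variable {E : Type*} [NormedAddCommGroup E] [InnerProductSpace ℝ E]

/-- `b` is the family of barycentric coordinates, extended by zero, of the point `p` of the simplex
with vertices `t`. -/
def IsBarycentric (t : Finset E) (b : E → ℝ) (p : E) : Prop :=
  (∀ y, 0 ≤ b y) ∧ (∀ y ∉ t, b y = 0) ∧ ∑ y ∈ t, b y = 1 ∧ ∑ y ∈ t, b y • y = p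

theorem IsBarycentric.mem_convexHull {t : Finset E} {b : E → ℝ} {p : E} (h : IsBarycentric t b p) :
    p ∈ convexHull ℝ (t : Set E) :=
  Finset.mem_convexHull'.2 ⟨b, fun y _ => h.1 y, h.2.2⟩

theorem IsBarycentric.mono {t t' : Finset E} {b : E → ℝ} {p : E} (h : IsBarycentric t b p)
    (ht : t ⊆ t') : IsBarycentric t' b p := by
  refine ⟨h.1, fun y hy => h.2.1 y fun hy' => hy (ht hy'), ?_, ?_⟩
  · rw [← Finset.sum_subset ht fun y _ hy => h.2.1 y hy, h.2.2.1]
  · rw [← Finset.sum_subset ht fun y _ hy => by rw [h.2.1 y hy, zero_smul], h.2.2.2]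

open Classical in
theorem exists_isBarycentric {t : Finset E} {p : E} (hp : p ∈ convexHull ℝ (t : Set E)) :
    ∃ b, IsBarycentric t b p := by
  obtain ⟨w, h0, h1, h2⟩ := Finset.mem_convexHull'.1 hp
  refine ⟨fun y => if y ∈ t then w y else 0, fun y => ?_, fun y hy => if_neg hy, ?_, ?_⟩
  · dsimp only
    split_ifs with hy
    exacts [h0 y hy, le_rfl]
  · rw [← h1]
    exact Finset.sum_congr rfl fun y hy => if_pos hy
  · rw [← h2]
    exact Finset.sum_congr rfl fun y hy => congrArg (· • y) (if_pos hy)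

theorem IsBarycentric.unique {t : Finset E} {b b' : E → ℝ} {p : E}
    (ht : AffineIndependent ℝ ((↑) : t → E)) (h : IsBarycentric t b p)
    (h' : IsBarycentric t b' p) : b = b' := by
  ext y
  by_cases hy : y ∈ t
  · refine sub_eq_zero.1 (ht.eq_zero_of_sum_eq_zero_subtype (w := fun y => b y - b' y) ?_ ?_ y hy)
    · rw [Finset.sum_sub_distrib, h.2.2.1, h'.2.2.1, sub_self]
    · simp only [sub_smul]
      rw [Finset.sum_sub_distrib, h.2.2.2, h'.2.2.2, sub_self]
  · rw [h.2.1 y hy, h'.2.1 y hy]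

open Classical in
/-- In a simplicial complex, the barycentric coordinates of a point do not depend on the simplex
that is used. -/
theorem IsBarycentric.unique_of_mem_faces {K : SimplicialComplex ℝ E} {t t' : Finset E}
    {b b' : E → ℝ} {p : E} (ht : t ∈ K.faces) (ht' : t' ∈ K.faces) (h : IsBarycentric t b p)
    (h' : IsBarycentric t' b' p) : b = b' := by
  have hp := K.inter_subset_convexHull ht ht' ⟨h.mem_convexHull, h'.mem_convexHull⟩
  rw [← Finset.coe_inter] at hp
  obtain ⟨b'', hb⟩ := exists_isBarycentric hp
  rw [h.unique (K.indep ht) (hb.mono Finset.inter_subset_left),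
    h'.unique (K.indep ht') (hb.mono Finset.inter_subset_right)]

theorem exists_dist_lt_mem_of_mem_intrinsicInterior {F : Set E} {x : E}
    (hx : x ∈ intrinsicInterior ℝ F) :
    ∃ r > 0, ∀ y ∈ affineSpan ℝ F, dist y x < r → y ∈ F := by
  obtain ⟨z, hz, rfl⟩ := mem_intrinsicInterior.1 hx
  obtain ⟨r, hr, hball⟩ := Metric.isOpen_iff.1 isOpen_interior z hz
  refine ⟨r, hr, fun y hy hyz => ?_⟩
  have h : (⟨y, hy⟩ : affineSpan ℝ F) ∈ Metric.ball z r := hyz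
  exact interior_subset (s := ((↑) ⁻¹' F : Set (affineSpan ℝ F))) (hball h)

open Classical in
/-- A simplex of a complex that meets the relative interior of a face contains that face. -/
theorem subset_of_mem_intrinsicInterior {K : SimplicialComplex ℝ E} {s t : Finset E}
    (hs : s ∈ K.faces) (ht : t ∈ K.faces) {x : E}
    (hx : x ∈ intrinsicInterior ℝ (convexHull ℝ (s : Set E)))
    (hxt : x ∈ convexHull ℝ (t : Set E)) : s ⊆ t := by
  intro j hj
  by_contra hjt
  obtain ⟨r, hr, hball⟩ := exists_dist_lt_mem_of_mem_intrinsicInterior hx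
  obtain ⟨b, hb⟩ := exists_isBarycentric hxt
  have hxs := intrinsicInterior_subset hx
  have hjs : j ∈ convexHull ℝ (s : Set E) := subset_convexHull ℝ _ hj
  -- push `x` slightly away from the vertex `j`, staying in the face
  obtain ⟨e, he, her⟩ : ∃ e : ℝ, 0 < e ∧ e * ‖x - j‖ < r := by
    refine ⟨r / (‖x - j‖ + 1), by positivity, ?_⟩
    rw [div_mul_eq_mul_div, div_lt_iff₀ (by positivity)]
    nlinarith [norm_nonneg (x - j)]
  have hz : x + e • (x - j) ∈ convexHull ℝ (s : Set E) := by
    refine hball _ ?_ ?_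
    · have := AffineMap.lineMap_mem (k := ℝ) (-e) (subset_affineSpan ℝ _ hxs)
        (subset_affineSpan ℝ _ hjs)
      rw [AffineMap.lineMap_apply_module'] at this
      convert this using 1
      module
    · rw [dist_eq_norm, add_sub_cancel_left, norm_smul, Real.norm_of_nonneg he.le]
      exact her
  obtain ⟨b₁, hb₁⟩ := exists_isBarycentric hz
  have hx' : IsBarycentric s (fun y => (1 + e)⁻¹ * (b₁ y + if y = j then e else 0)) x := by
    refine ⟨fun y => ?_, fun y hy => ?_, ?_, ?_⟩
    · have := hb₁.1 y
      dsimp only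
      split_ifs <;> positivity
    · have : y ≠ j := fun h => hy (h ▸ hj)
      simp [hb₁.2.1 y hy, this]
    · rw [← Finset.mul_sum, Finset.sum_add_distrib, hb₁.2.2.1, Finset.sum_ite_eq', if_pos hj]
      exact inv_mul_cancel₀ (by positivity)
    · simp only [mul_smul, ← Finset.smul_sum, add_smul, ite_smul, zero_smul,
        Finset.sum_add_distrib, hb₁.2.2.2, Finset.sum_ite_eq', if_pos hj]
      rw [show x + e • (x - j) + e • j = (1 + e) • x by module, smul_smul,
        inv_mul_cancel₀ (by positivity), one_smul]
  have h1 := congrFun (hb.unique_of_mem_faces ht hs hx') j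
  rw [hb.2.1 j hjt] at h1
  have h2 := hb₁.1 j
  have : 0 < (1 + e)⁻¹ * (b₁ j + if j = j then e else 0) := by
    rw [if_pos rfl]
    positivity
  exact this.ne h1

end Barycentric

section Link

variable {E : Type*} [NormedAddCommGroup E] [InnerProductSpace ℝ E]

/-- The vertices of a simplicial complex, as a type. -/
abbrev VertexType (K : SimplicialComplex ℝ E) : Type _ := {v : E // ∃ t ∈ K.faces, v ∈ t}

theorem finite_vertexType {K : SimplicialComplex ℝ E} (hK : K.faces.Finite) :
    Finite (VertexType K) := by
  have : {v : E | ∃ t ∈ K.faces, v ∈ t} = ⋃ t ∈ K.faces, (t : Set E) := by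
    ext v
    simp
  have h : {v : E | ∃ t ∈ K.faces, v ∈ t}.Finite := by
    rw [this]
    exact hK.biUnion fun t _ => t.finite_toSet
  exact h.to_subtype

/-- The link of the face `s`, including the empty simplex: the sets of vertices outside `s` that
span a simplex together with `s`. -/
def linkFamily (K : SimplicialComplex ℝ E) (s : Finset E) : Set (Finset (VertexType K)) :=
  {u | (∀ i ∈ u, (i : E) ∉ s) ∧ ∃ t ∈ K.faces, s ⊆ t ∧ ∀ i ∈ u, (i : E) ∈ t}

theorem linkFamily_nonempty {K : SimplicialComplex ℝ E} {s : Finset E} (hs : s ∈ K.faces) :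
    (linkFamily K s).Nonempty :=
  ⟨∅, by simp, s, hs, le_rfl, by simp⟩

theorem convexHull_subset_of_zero_mem {s : Finset E} {U : Submodule ℝ E}
    (hU : U = vectorSpan ℝ (convexHull ℝ (s : Set E)))
    (h0 : (0 : E) ∈ intrinsicInterior ℝ (convexHull ℝ (s : Set E))) :
    convexHull ℝ (s : Set E) ⊆ U := by
  intro y hy
  have := vsub_mem_vectorSpan ℝ hy (intrinsicInterior_subset h0)
  simpa [hU] using this

theorem mem_affineSpan_of_mem {s : Finset E} {U : Submodule ℝ E}
    (hU : U = vectorSpan ℝ (convexHull ℝ (s : Set E)))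
    (h0 : (0 : E) ∈ intrinsicInterior ℝ (convexHull ℝ (s : Set E)))
    {y : E} (hy : y ∈ U) :
    y ∈ affineSpan ℝ (convexHull ℝ (s : Set E)) := by
  rw [hU, ← direction_affineSpan] at hy
  simpa using AffineSubspace.vadd_mem_of_mem_direction hy
    (subset_affineSpan ℝ _ (intrinsicInterior_subset h0))

variable {K : SimplicialComplex ℝ E} [Fintype (VertexType K)] {s : Finset E}

theorem sum_eq_sum_vertexType {A : Type*} [AddCommMonoid A] {t : Finset E} (ht : t ∈ K.faces)
    (f : E → A) (hf : ∀ y ∉ t, f y = 0) : ∑ y ∈ t, f y = ∑ i : VertexType K, f i := by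
  refine Eq.trans (Finset.sum_subset (fun y hy => ?_) fun y _ hy => hf y hy)
    (Finset.sum_map Finset.univ (Function.Embedding.subtype _) f)
  exact Finset.mem_map.2 ⟨⟨y, t, ht, hy⟩, Finset.mem_univ _, rfl⟩

open Classical in
/-- A combination of a point of the face `s` and of vertices in its link lies in a simplex of the
complex, and the coefficients of the link vertices are its barycentric coordinates. -/
theorem exists_isBarycentric_add_sum {c : VertexType K → ℝ} (hc : c ∈ supportCone (linkFamily K s))
    (hc1 : ∑ i, c i ≤ 1) {x : E} (hx : x ∈ convexHull ℝ (s : Set E)) :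
    ∃ t ∈ K.faces, ∃ b, IsBarycentric t b ((1 - ∑ i, c i) • x + ∑ i, c i • (i : E)) ∧
      ∀ i : VertexType K, (i : E) ∉ s → b i = c i := by
  obtain ⟨h0, u, ⟨hus, t, ht, hst, hut⟩, hcu⟩ := hc
  obtain ⟨e, he⟩ := exists_isBarycentric hx
  replace he := he.mono hst
  have hes : ∀ y ∉ s, e y = 0 := fun y hy => by
    obtain ⟨e', he'⟩ := exists_isBarycentric hx
    rw [he.unique (K.indep ht) (he'.mono hst)]
    exact he'.2.1 y hy
  let C : E → ℝ := Function.extend Subtype.val c 0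
  have hCv : ∀ i : VertexType K, C i = c i := fun i => Subtype.val_injective.extend_apply c 0 i
  have hC0 : ∀ y ∉ t, C y = 0 := fun y hy => by
    by_cases h : ∃ i : VertexType K, (i : E) = y
    · obtain ⟨i, rfl⟩ := h
      rw [hCv]
      exact hcu i fun hi => hy (hut i hi)
    · exact Function.extend_apply' _ _ _ h
  have hCnn : ∀ y, 0 ≤ C y := fun y => by
    by_cases h : ∃ i : VertexType K, (i : E) = y
    · obtain ⟨i, rfl⟩ := h
      rw [hCv]
      exact h0 i
    · exact (Function.extend_apply' c (0 : E → ℝ) y h).ge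
  refine ⟨t, ht, fun y => (1 - ∑ i, c i) * e y + C y, ⟨fun y => ?_, fun y hy => ?_, ?_, ?_⟩,
    fun i hi => ?_⟩
  · exact add_nonneg (mul_nonneg (sub_nonneg.2 hc1) (he.1 y)) (hCnn y)
  · simp only [he.2.1 y hy, hC0 y hy, mul_zero, add_zero]
  · rw [Finset.sum_add_distrib, ← Finset.mul_sum, he.2.2.1, sum_eq_sum_vertexType ht C hC0]
    simp only [hCv]
    ring
  · simp only [add_smul, mul_smul, Finset.sum_add_distrib, ← Finset.smul_sum, he.2.2.2]
    rw [sum_eq_sum_vertexType ht (fun y => C y • y) fun y hy => by rw [hC0 y hy, zero_smul]]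
    simp only [hCv]
  · change (1 - ∑ i, c i) * e i + C i = c i
    rw [hes i hi, hCv, mul_zero, zero_add]

theorem eq_of_add_sum_eq {c c' : VertexType K → ℝ} (hc : c ∈ supportCone (linkFamily K s))
    (hc' : c' ∈ supportCone (linkFamily K s)) (hc1 : ∑ i, c i ≤ 1) (hc1' : ∑ i, c' i ≤ 1) {x x' : E}
    (hx : x ∈ convexHull ℝ (s : Set E)) (hx' : x' ∈ convexHull ℝ (s : Set E))
    (h : (1 - ∑ i, c i) • x + ∑ i, c i • (i : E) = (1 - ∑ i, c' i) • x' + ∑ i, c' i • (i : E)) :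
    c = c' := by
  obtain ⟨t, ht, b, hb, hbc⟩ := exists_isBarycentric_add_sum hc hc1 hx
  obtain ⟨t', ht', b', hb', hbc'⟩ := exists_isBarycentric_add_sum hc' hc1' hx'
  rw [h] at hb
  have hbb := hb.unique_of_mem_faces ht ht' hb'
  have hzero : ∀ {c : VertexType K → ℝ}, c ∈ supportCone (linkFamily K s) →
      ∀ i : VertexType K, (i : E) ∈ s → c i = 0 := by
    rintro c ⟨-, u, ⟨hus, -⟩, hcu⟩ i hi
    exact hcu i fun hiu => hus i hiu hi
  ext i
  by_cases hi : (i : E) ∈ s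
  · rw [hzero hc i hi, hzero hc' i hi]
  · rw [← hbc i hi, ← hbc' i hi, hbb]

variable [FiniteDimensional ℝ E]

/-- The generator of the normal fan that belongs to a vertex: its projection to the orthogonal
complement of the subspace `U`. -/
def normalGenerator (K : SimplicialComplex ℝ E) (U : Submodule ℝ E) (i : VertexType K) : E :=
  Uᗮ.starProjection i

theorem linearCombination_normalGenerator (U : Submodule ℝ E) (c : VertexType K → ℝ) :
    Fintype.linearCombination ℝ (normalGenerator K U) c =
      Uᗮ.starProjection (∑ i, c i • (i : E)) := by
  simp [Fintype.linearCombination_apply, normalGenerator]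

theorem starProjection_orthogonal_eq_zero_iff {U : Submodule ℝ E} {y : E} :
    Uᗮ.starProjection y = 0 ↔ y ∈ U := by
  rw [Submodule.starProjection_apply_eq_zero_iff, Submodule.orthogonal_orthogonal]

/-- The normal fan of a face is simplicial: its generators parametrize it injectively. -/
theorem injOn_linearCombination_normalGenerator {U : Submodule ℝ E}
    (hU : U = vectorSpan ℝ (convexHull ℝ (s : Set E)))
    (h0 : (0 : E) ∈ intrinsicInterior ℝ (convexHull ℝ (s : Set E))) :
    InjOn (Fintype.linearCombination ℝ (normalGenerator K U)) (supportCone (linkFamily K s)) := by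
  intro c hc c' hc' h
  rw [linearCombination_normalGenerator, linearCombination_normalGenerator, ← sub_eq_zero,
    ← map_sub, starProjection_orthogonal_eq_zero_iff] at h
  obtain ⟨r, hr, hball⟩ := exists_dist_lt_mem_of_mem_intrinsicInterior h0
  set d : E := ∑ i, c i • (i : E) - ∑ i, c' i • (i : E) with hd
  -- shrink everything so that the comparison takes place inside the complex
  obtain ⟨e, he, h1, h2, h3⟩ : ∃ e : ℝ, 0 < e ∧ e * ∑ i, c i < 1 ∧ e * ∑ i, c' i < 1 ∧
      ‖(e / (1 - e * ∑ i, c' i)) • d‖ < r := by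
    have t1 : ∀ m : ℝ, ∀ᶠ e in 𝓝[>] (0 : ℝ), e * m < 1 := fun m => by
      have : Tendsto (fun e : ℝ => e * m) (𝓝[>] 0) (𝓝 0) := by
        have : Continuous fun e : ℝ => e * m := by fun_prop
        simpa using (this.tendsto 0).mono_left nhdsWithin_le_nhds
      exact this.eventually_lt_const one_pos
    have t2 : ∀ᶠ e in 𝓝[>] (0 : ℝ), ‖(e / (1 - e * ∑ i, c' i)) • d‖ < r := by
      have : ContinuousAt (fun e : ℝ => ‖(e / (1 - e * ∑ i, c' i)) • d‖) 0 := by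
        refine ContinuousAt.norm (ContinuousAt.smul (ContinuousAt.div ?_ ?_ ?_) ?_)
        · fun_prop
        · fun_prop
        · simp
        · fun_prop
      have := this.tendsto.mono_left (nhdsWithin_le_nhds (s := Ioi 0))
      refine this.eventually_lt_const ?_
      simpa using hr
    obtain ⟨e, ⟨⟨ha, hb⟩, hc⟩, he⟩ :=
      (((t1 (∑ i, c i)).and (t1 (∑ i, c' i))).and t2).and self_mem_nhdsWithin |>.exists
    exact ⟨e, he, ha, hb, hc⟩
  have hm : 0 < 1 - e * ∑ i, c' i := sub_pos.2 h2
  have hx' : (e / (1 - e * ∑ i, c' i)) • d ∈ convexHull ℝ (s : Set E) := by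
    refine hball _ (mem_affineSpan_of_mem hU h0 (U.smul_mem _ h)) ?_
    rwa [dist_zero_right]
  have hsum : ∀ c : VertexType K → ℝ, ∑ i, (e • c) i = e * ∑ i, c i := fun c => by
    simp [Finset.mul_sum]
  have hsum' : ∀ c : VertexType K → ℝ, ∑ i, (e • c) i • (i : E) = e • ∑ i, c i • (i : E) :=
    fun c => by simp [Finset.smul_sum, mul_smul]
  have key := eq_of_add_sum_eq (smul_mem_supportCone hc he.le) (smul_mem_supportCone hc' he.le)
    ((hsum c).trans_le h1.le) ((hsum c').trans_le h2.le) (intrinsicInterior_subset h0) hx' (by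
      rw [hsum, hsum, hsum', hsum', smul_smul, mul_div_cancel₀ _ hm.ne', hd]
      module)
  have := congrArg (fun z => e⁻¹ • z) key
  simpa [smul_smul, he.ne'] using this

/-- Near any interior point of the face, the complex is the preimage of the normal fan under the
orthogonal projection along the face. -/
theorem exists_forall_mem_space_iff {U : Submodule ℝ E}
    (hU : U = vectorSpan ℝ (convexHull ℝ (s : Set E)))
    (h0 : (0 : E) ∈ intrinsicInterior ℝ (convexHull ℝ (s : Set E)))
    (hK : K.faces.Finite) (hs : s ∈ K.faces) {x : E}
    (hx : x ∈ intrinsicInterior ℝ (convexHull ℝ (s : Set E))) :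
    ∃ r > 0, ∀ y, ‖y - x‖ ≤ r → (y ∈ K.space ↔ Uᗮ.starProjection (y - x) ∈
      Fintype.linearCombination ℝ (normalGenerator K U) '' supportCone (linkFamily K s)) := by
  classical
  obtain ⟨r₀, hr₀, hball⟩ := exists_dist_lt_mem_of_mem_intrinsicInterior hx
  have hFU := convexHull_subset_of_zero_mem hU h0
  -- a ball about `x` that only meets the simplices containing the face
  obtain ⟨r₁, hr₁, hr₁'⟩ : ∃ r > 0, ∀ y, ‖y - x‖ < r → ∀ t ∈ K.faces, ¬s ⊆ t →
      y ∉ convexHull ℝ (t : Set E) := by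
    have hcl : IsClosed (⋃ t ∈ {t | t ∈ K.faces ∧ ¬s ⊆ t}, convexHull ℝ (t : Set E)) :=
      (hK.subset fun t ht => ht.1).isClosed_biUnion fun t _ =>
        t.finite_toSet.isClosed_convexHull ℝ
    have hxn : x ∈ (⋃ t ∈ {t | t ∈ K.faces ∧ ¬s ⊆ t}, convexHull ℝ (t : Set E))ᶜ := by
      simp only [mem_compl_iff, mem_iUnion, not_exists]
      exact fun t ht hxt => ht.2 (subset_of_mem_intrinsicInterior hs ht.1 hx hxt)
    obtain ⟨r, hr, h⟩ := Metric.isOpen_iff.1 hcl.isOpen_compl x hxn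
    refine ⟨r, hr, fun y hy t ht hst hyt => ?_⟩
    have := h (mem_ball_iff_norm.2 hy)
    simp only [mem_compl_iff, mem_iUnion, not_exists] at this
    exact this t ⟨ht, hst⟩ hyt
  obtain ⟨k, hk, hkL⟩ := exists_pos_mul_norm_le _ (injOn_linearCombination_normalGenerator
    (K := K) hU h0)
  set n : ℝ := ((Fintype.card (VertexType K) : ℕ) : ℝ) with hn
  obtain ⟨M, hM, hMb⟩ : ∃ M : ℝ, 0 ≤ M ∧ ∀ c : VertexType K → ℝ,
      ‖∑ i, c i • (i : E)‖ ≤ M * ‖c‖ := by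
    refine ⟨∑ i : VertexType K, ‖(i : E)‖, Finset.sum_nonneg fun i _ => norm_nonneg _, fun c => ?_⟩
    rw [Finset.sum_mul]
    refine (norm_sum_le _ _).trans (Finset.sum_le_sum fun i _ => ?_)
    rw [norm_smul, mul_comm]
    exact mul_le_mul_of_nonneg_left (norm_le_pi_norm c i) (norm_nonneg _)
  obtain ⟨r, hr, hrr₁, hrn, hrr₀⟩ : ∃ r : ℝ, 0 < r ∧ r < r₁ ∧ n * (r / k) < 1 / 2 ∧
      2 * (r + M * (r / k) + n * (r / k) * ‖x‖) < r₀ := by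
    have t1 : ∀ᶠ r in 𝓝[>] (0 : ℝ), n * (r / k) < 1 / 2 := by
      have : Continuous fun r : ℝ => n * (r / k) := by fun_prop
      refine ((this.tendsto 0).mono_left nhdsWithin_le_nhds).eventually_lt_const ?_
      norm_num
    have t2 : ∀ᶠ r in 𝓝[>] (0 : ℝ), 2 * (r + M * (r / k) + n * (r / k) * ‖x‖) < r₀ := by
      have : Continuous fun r : ℝ => 2 * (r + M * (r / k) + n * (r / k) * ‖x‖) := by fun_prop
      refine ((this.tendsto 0).mono_left nhdsWithin_le_nhds).eventually_lt_const ?_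
      simpa using hr₀
    obtain ⟨r, ⟨ha, hb⟩, hc⟩ := ((t1.and t2).and (Ioo_mem_nhdsGT hr₁)).exists
    exact ⟨r, hc.1, hc.2, ha, hb⟩
  refine ⟨r, hr, fun y hy => ⟨fun hyK => ?_, ?_⟩⟩
  · obtain ⟨t, ht, hyt⟩ := SimplicialComplex.mem_space_iff.1 hyK
    have hst : s ⊆ t := by
      by_contra hst
      exact hr₁' y (hy.trans_lt hrr₁) t ht hst hyt
    obtain ⟨b, hb⟩ := exists_isBarycentric hyt
    refine ⟨fun i => if (i : E) ∈ s then 0 else b i, ⟨fun i => ?_, ?_⟩, ?_⟩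
    · dsimp only
      split_ifs
      exacts [le_rfl, hb.1 _]
    · refine ⟨Finset.univ.filter fun i => (i : E) ∈ t ∧ (i : E) ∉ s, ⟨fun i hi => ?_, t, ht, hst,
        fun i hi => ?_⟩, fun i hi => ?_⟩
      · exact (Finset.mem_filter.1 hi).2.2
      · exact (Finset.mem_filter.1 hi).2.1
      · dsimp only
        split_ifs with h
        · rfl
        · refine hb.2.1 _ fun hit => hi ?_
          exact Finset.mem_filter.2 ⟨Finset.mem_univ _, hit, h⟩
    · have hxU : Uᗮ.starProjection x = 0 :=
        starProjection_orthogonal_eq_zero_iff.2 (hFU (intrinsicInterior_subset hx))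
      rw [map_sub, hxU, sub_zero, ← hb.2.2.2, map_sum, Fintype.linearCombination_apply]
      have h1 : ∑ z ∈ t, Uᗮ.starProjection (b z • z) =
          ∑ i : VertexType K, Uᗮ.starProjection (b i • (i : E)) := by
        refine sum_eq_sum_vertexType ht _ fun y hy => ?_
        rw [hb.2.1 y hy, zero_smul, map_zero]
      rw [h1]
      refine Finset.sum_congr rfl fun i _ => ?_
      split_ifs with h
      · rw [zero_smul, map_smul, starProjection_orthogonal_eq_zero_iff.2
          (hFU (subset_convexHull ℝ _ h)), smul_zero]
      · rw [map_smul, normalGenerator]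
  · rintro ⟨c, hc, hcy⟩
    have hcn : ‖c‖ ≤ r / k := by
      rw [le_div_iff₀ hk, mul_comm]
      refine (hkL c hc).trans ?_
      rw [hcy]
      exact (Submodule.norm_starProjection_apply_le _ _).trans hy
    have hm : ∑ i, c i ≤ n * (r / k) := by
      calc ∑ i, c i ≤ ∑ _i : VertexType K, r / k := Finset.sum_le_sum fun i _ =>
            (le_abs_self _).trans ((norm_le_pi_norm c i).trans hcn)
        _ = n * (r / k) := by simp [hn]
    have hm0 : 0 ≤ ∑ i, c i := Finset.sum_nonneg fun i _ => hc.1 i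
    set m : ℝ := ∑ i, c i with hmdef
    set p : E := ∑ i, c i • (i : E) with hp
    have hpn : ‖p‖ ≤ M * (r / k) := (hMb c).trans (mul_le_mul_of_nonneg_left hcn hM)
    have hu : y - x - p ∈ U := by
      rw [← starProjection_orthogonal_eq_zero_iff, map_sub, ← hcy,
        linearCombination_normalGenerator, sub_self]
    have hm1 : 0 < 1 - m := by linarith
    -- `y` is a combination of the link vertices and of a point of the face
    have hx' : (1 - m)⁻¹ • (x + (y - x - p)) ∈ convexHull ℝ (s : Set E) := by
      refine hball _ (mem_affineSpan_of_mem hU h0 (U.smul_mem _ (U.add_mem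
        (hFU (intrinsicInterior_subset hx)) hu))) ?_
      have h1 : (1 - m)⁻¹ • (x + (y - x - p)) - x = (1 - m)⁻¹ • ((y - x) - p + m • x) := by
        have h2 : x = (1 - m)⁻¹ • ((1 - m) • x) := by
          rw [smul_smul, inv_mul_cancel₀ hm1.ne', one_smul]
        nth_rewrite 3 [h2]
        rw [← smul_sub]
        congr 1
        module
      rw [dist_eq_norm, h1, norm_smul, Real.norm_of_nonneg (inv_nonneg.2 hm1.le)]
      have h2 : ‖(y - x) - p + m • x‖ ≤ r + M * (r / k) + n * (r / k) * ‖x‖ := by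
        refine (norm_add_le _ _).trans (add_le_add ((norm_sub_le _ _).trans (add_le_add hy hpn)) ?_)
        rw [norm_smul, Real.norm_of_nonneg hm0]
        exact mul_le_mul_of_nonneg_right hm (norm_nonneg _)
      have h3 : (1 - m)⁻¹ ≤ 2 := by
        rw [inv_le_comm₀ hm1 two_pos]
        linarith
      calc (1 - m)⁻¹ * ‖(y - x) - p + m • x‖ ≤ 2 * (r + M * (r / k) + n * (r / k) * ‖x‖) :=
            mul_le_mul h3 h2 (norm_nonneg _) two_pos.le
        _ < r₀ := hrr₀
    obtain ⟨t, ht, b, hb, -⟩ := exists_isBarycentric_add_sum hc (by linarith) hx'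
    refine SimplicialComplex.mem_space_iff.2 ⟨t, ht, ?_⟩
    have h4 := hb.mem_convexHull
    rw [← hmdef, ← hp, smul_smul, mul_inv_cancel₀ hm1.ne', one_smul] at h4
    convert h4 using 1
    abel

end Link

/-! ### The orthogonal group acting on normal spaces -/

section Action

variable {E : Type*} [NormedAddCommGroup E] [InnerProductSpace ℝ E] [FiniteDimensional ℝ E]
  {U W : Submodule ℝ E}

theorem orthogonalProjectionOnto_actFixing (j : W ≃ₗᵢ[ℝ] Uᗮ) (g : OrthGroup W) (y : E) :
    U.orthogonalProjectionOnto (actFixing U j g y) = U.orthogonalProjectionOnto y := by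
  rw [actFixing, map_add, Submodule.orthogonalProjectionOnto_mem_subspace_eq_self,
    Submodule.orthogonalProjectionOnto_eq_zero_iff.2 (Subtype.prop _), add_zero]

theorem orthogonalProjectionOnto_orthogonal_actFixing (j : W ≃ₗᵢ[ℝ] Uᗮ) (g : OrthGroup W) (y : E) :
    Uᗮ.orthogonalProjectionOnto (actFixing U j g y) =
      j ((g : W →L[ℝ] W) (j.symm (Uᗮ.orthogonalProjectionOnto y))) := by
  rw [actFixing, map_add, Submodule.orthogonalProjectionOnto_mem_subspace_eq_self,
    Submodule.orthogonalProjectionOnto_eq_zero_iff.2, zero_add]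
  rw [Submodule.orthogonal_orthogonal]
  exact Subtype.prop _

theorem actFixing_mul (j : W ≃ₗᵢ[ℝ] Uᗮ) (g h : OrthGroup W) (y : E) :
    actFixing U j (g * h) y = actFixing U j g (actFixing U j h y) := by
  conv_rhs => rw [actFixing]
  rw [orthogonalProjectionOnto_actFixing, orthogonalProjectionOnto_orthogonal_actFixing, actFixing]
  simp

theorem actFixing_one (j : W ≃ₗᵢ[ℝ] Uᗮ) (y : E) : actFixing U j 1 y = y := by
  rw [actFixing]
  simp

theorem norm_actFixing (j : W ≃ₗᵢ[ℝ] Uᗮ) (g : OrthGroup W) (y : E) :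
    ‖actFixing U j g y‖ = ‖y‖ := by
  rw [← sq_eq_sq₀ (norm_nonneg _) (norm_nonneg _),
    Submodule.norm_sq_eq_add_norm_sq_projection (actFixing U j g y) U,
    Submodule.norm_sq_eq_add_norm_sq_projection y U, orthogonalProjectionOnto_actFixing,
    orthogonalProjectionOnto_orthogonal_actFixing, LinearIsometryEquiv.norm_map,
    ContinuousLinearMap.norm_map_of_mem_unitary g.2, LinearIsometryEquiv.norm_map]

/-- The action `actFixing` of an element of the orthogonal group, as a linear isometry. -/
def actFixingIsometry (j : W ≃ₗᵢ[ℝ] Uᗮ) (g : OrthGroup W) : E ≃ₗᵢ[ℝ] E where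
  toFun := actFixing U j g
  invFun := actFixing U j g⁻¹
  map_add' x y := by
    simp only [actFixing, map_add, Submodule.coe_add]
    abel
  map_smul' c x := by
    simp only [actFixing, map_smul, Submodule.coe_smul, smul_add, RingHom.id_apply]
  left_inv y := by rw [← actFixing_mul, inv_mul_cancel, actFixing_one]
  right_inv y := by rw [← actFixing_mul, mul_inv_cancel, actFixing_one]
  norm_map' := norm_actFixing j g

theorem coe_actFixingIsometry (j : W ≃ₗᵢ[ℝ] Uᗮ) (g : OrthGroup W) :
    ⇑(actFixingIsometry j g) = actFixing U j g := rfl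

theorem coe_actFixingIsometry_symm (j : W ≃ₗᵢ[ℝ] Uᗮ) (g : OrthGroup W) :
    ⇑(actFixingIsometry j g).symm = actFixing U j g⁻¹ := rfl

theorem inner_actFixing_left (j : W ≃ₗᵢ[ℝ] Uᗮ) (g : OrthGroup W) (x y : E) :
    ⟪actFixing U j g x, y⟫_ℝ = ⟪x, actFixing U j g⁻¹ y⟫_ℝ := by
  rw [← coe_actFixingIsometry, ← coe_actFixingIsometry_symm,
    ← LinearIsometryEquiv.inner_map_map (actFixingIsometry j g) x,
    LinearIsometryEquiv.apply_symm_apply]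

theorem actFixing_coe (j : W ≃ₗᵢ[ℝ] Uᗮ) (g : OrthGroup W) (b : Uᗮ) :
    actFixing U j g b = j ((g : W →L[ℝ] W) (j.symm b)) := by
  rw [actFixing, Submodule.orthogonalProjectionOnto_eq_zero_iff.2 b.2,
    Submodule.orthogonalProjectionOnto_mem_subspace_eq_self]
  simp

theorem starProjection_actFixing (j : W ≃ₗᵢ[ℝ] Uᗮ) (g : OrthGroup W) (y : E) :
    Uᗮ.starProjection (actFixing U j g y) = actFixing U j g (Uᗮ.starProjection y) := by
  rw [Submodule.starProjection_apply, Submodule.starProjection_apply,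
    orthogonalProjectionOnto_orthogonal_actFixing, actFixing_coe]

end Action

/-! ### The index of a fan as a function of the direction -/

section FanIndex

variable {ι : Type u} {E : Type u} [NormedAddCommGroup E] [InnerProductSpace ℝ E]
  {𝒦 : Set (Finset ι)} {w : ι → E} {X : Set E}

theorem linearCombination_mem [Fintype ι] {U : Submodule ℝ E} {w : ι → E} (hw : ∀ i, w i ∈ U)
    (c : ι → ℝ) :
    Fintype.linearCombination ℝ w c ∈ U := by
  rw [Fintype.linearCombination_apply]
  exact Submodule.sum_mem _ fun i _ => U.smul_mem _ (hw i)

/-- The index at the origin of the simplicial fan with generators `w` and cones indexed by `𝒦`, as a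
function of the direction `a`, computed from the cubical model. -/
def CurvatureMap.fanIndex (ρ : CurvatureMap.{u}) (𝒦 : Set (Finset ι)) (w : ι → E) (a : E) : ℝ :=
  ρ.modelValue 𝒦 {i | 0 < ⟪w i, a⟫_ℝ}

theorem IsFanAt.index_eq [Fintype ι] {x : E} (h : IsFanAt 𝒦 w X x) (h𝒦 : 𝒦.Nonempty)
    (ρ : CurvatureMap.{u}) (a : E) : ρ.index X x a = ρ.fanIndex 𝒦 w a :=
  (h.isIndex h𝒦 ρ a).index_eq

theorem CurvatureMap.fanIndex_actFixing [FiniteDimensional ℝ E] {U W : Submodule ℝ E}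
    (ρ : CurvatureMap.{u}) (j : W ≃ₗᵢ[ℝ] Uᗮ) (g : OrthGroup W)
    (a : E) : ρ.fanIndex 𝒦 (fun i => actFixing U j g (w i)) a =
      ρ.fanIndex 𝒦 w (actFixing U j g⁻¹ a) := by
  simp only [CurvatureMap.fanIndex, inner_actFixing_left]

theorem CurvatureMap.fanIndex_smul (ρ : CurvatureMap.{u}) {t : ℝ} (ht : 0 < t) (a : E) :
    ρ.fanIndex 𝒦 w (t • a) = ρ.fanIndex 𝒦 w a := by
  simp only [CurvatureMap.fanIndex, inner_smul_right, mul_pos_iff_of_pos_left ht]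

theorem CurvatureMap.fanIndex_starProjection [FiniteDimensional ℝ E] {U : Submodule ℝ E}
    (ρ : CurvatureMap.{u}) (hw : ∀ i, w i ∈ Uᗮ) (a : E) :
    ρ.fanIndex 𝒦 w (Uᗮ.starProjection a) = ρ.fanIndex 𝒦 w a := by
  have : ∀ i, ⟪w i, Uᗮ.starProjection a⟫_ℝ = ⟪w i, a⟫_ℝ := fun i => by
    rw [← Submodule.inner_starProjection_left_eq_right,
      Submodule.starProjection_eq_self_iff.2 (hw i)]
  simp only [CurvatureMap.fanIndex, this]

theorem CurvatureMap.exists_abs_fanIndex_le [Finite ι] (ρ : CurvatureMap.{u}) (𝒦 : Set (Finset ι))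
    (w : ι → E) : ∃ C, ∀ a, |ρ.fanIndex 𝒦 w a| ≤ C := by
  obtain ⟨C, hC⟩ := (toFinite (range fun S : Set ι => |ρ.modelValue 𝒦 S|)).bddAbove
  exact ⟨C, fun a => hC ⟨_, rfl⟩⟩

theorem CurvatureMap.measurable_fanIndex [Finite ι] [MeasurableSpace E] [BorelSpace E]
    (ρ : CurvatureMap.{u}) (𝒦 : Set (Finset ι)) (w : ι → E) : Measurable (ρ.fanIndex 𝒦 w) := by
  have h1 : Measurable fun a : E => fun i => 0 < ⟪w i, a⟫_ℝ := by
    refine measurable_pi_lambda _ fun i => ?_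
    refine measurableSet_setOfPred.1 (measurableSet_lt measurable_const ?_)
    exact (continuous_const.inner continuous_id).measurable
  have h2 : Measurable fun p : ι → Prop => ρ.modelValue 𝒦 {i | p i} := Measurable.of_discrete
  exact h2.comp h1

end FanIndex

/-! ### Sets with a conical normal structure along a subspace -/

section NormalFan

variable {ι κ : Type u} [Fintype ι] [Fintype κ] {E : Type u} [NormedAddCommGroup E]
  [InnerProductSpace ℝ E] [FiniteDimensional ℝ E]

/-- Near `x`, the set `X` is the product of the subspace `U` and of a simplicial fan in `Uᗮ` with
generators `w` and cones indexed by `𝒦`. -/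
def IsNormalFanAt (U : Submodule ℝ E) (𝒦 : Set (Finset ι)) (w : ι → E) (X : Set E) (x : E) : Prop :=
  (∀ i, w i ∈ Uᗮ) ∧ InjOn (Fintype.linearCombination ℝ w) (supportCone 𝒦) ∧
    ∃ r > 0, ∀ y, ‖y - x‖ ≤ r →
      (y ∈ X ↔ Uᗮ.starProjection (y - x) ∈ Fintype.linearCombination ℝ w '' supportCone 𝒦)

/-- A simplicial complex has the same normal fan at all interior points of a face. -/
theorem isNormalFanAt_space {K : SimplicialComplex ℝ E} [Fintype (VertexType K)] {s : Finset E}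
    {U : Submodule ℝ E} (hU : U = vectorSpan ℝ (convexHull ℝ (s : Set E)))
    (h0 : (0 : E) ∈ intrinsicInterior ℝ (convexHull ℝ (s : Set E)))
    (hK : K.faces.Finite) (hs : s ∈ K.faces) {x : E}
    (hx : x ∈ intrinsicInterior ℝ (convexHull ℝ (s : Set E))) :
    IsNormalFanAt U (linkFamily K s) (normalGenerator K U) K.space x :=
  ⟨fun _ => Submodule.starProjection_apply_mem _ _, injOn_linearCombination_normalGenerator hU h0,
    exists_forall_mem_space_iff hU h0 hK hs hx⟩

variable {U V W : Submodule ℝ E} {𝒦 : Set (Finset ι)} {w : ι → E} {X : Set E}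
  {ℒ : Set (Finset κ)} {v : κ → E} {Y : Set E}

theorem IsNormalFanAt.isFanAt_inter {x : E} (h : IsNormalFanAt U 𝒦 w X x) :
    IsFanAt 𝒦 w (X ∩ AffineSubspace.mk' x Uᗮ) x := by
  obtain ⟨hw, hinj, r, hr, hX⟩ := h
  refine ⟨hinj, r, hr, fun y hy => ?_⟩
  rw [mem_inter_iff, hX y hy, SetLike.mem_coe, AffineSubspace.mem_mk', vsub_eq_sub]
  constructor
  · rintro ⟨h1, h2⟩
    rwa [Submodule.starProjection_eq_self_iff.2 h2] at h1
  · intro h1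
    have h2 : y - x ∈ Uᗮ := by
      obtain ⟨c, -, hc⟩ := h1
      exact hc ▸ linearCombination_mem hw c
    rw [Submodule.starProjection_eq_self_iff.2 h2]
    exact ⟨h1, h2⟩

theorem IsNormalFanAt.image_actFixing (h : IsNormalFanAt U 𝒦 w X 0) (j : W ≃ₗᵢ[ℝ] Uᗮ)
    (g : OrthGroup W) :
    IsNormalFanAt U 𝒦 (fun i => actFixing U j g (w i)) (actFixing U j g '' X) 0 := by
  obtain ⟨hw, hinj, r, hr, hX⟩ := h
  have hL : ∀ c, Fintype.linearCombination ℝ (fun i => actFixing U j g (w i)) c =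
      actFixing U j g (Fintype.linearCombination ℝ w c) := fun c => by
    simp only [Fintype.linearCombination_apply, ← coe_actFixingIsometry, map_sum, map_smul]
  refine ⟨fun i => ?_, fun c hc c' hc' hcc => ?_, r, hr, fun y hy => ?_⟩
  · have := actFixing_coe j g ⟨w i, hw i⟩
    rw [Subtype.coe_mk] at this
    dsimp only
    rw [this]
    exact Subtype.prop _
  · rw [hL, hL] at hcc
    exact hinj hc hc' ((actFixingIsometry j g).injective hcc)
  · obtain ⟨z, rfl⟩ := (actFixingIsometry j g).surjective y
    rw [sub_zero, LinearIsometryEquiv.norm_map] at hy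
    rw [sub_zero, coe_actFixingIsometry, starProjection_actFixing, ← coe_actFixingIsometry,
      (actFixingIsometry j g).injective.mem_set_image, hX z (by rwa [sub_zero]), sub_zero]
    constructor
    · rintro ⟨c, hc, hcz⟩
      exact ⟨c, hc, (hL c).trans (congrArg _ hcz)⟩
    · rintro ⟨c, hc, hcz⟩
      exact ⟨c, hc, (actFixingIsometry j g).injective ((hL c).symm.trans hcz)⟩

theorem isCompl_orthogonal_of_isCompl (h : IsCompl U V) : IsCompl Uᗮ Vᗮ := by
  constructor
  · rw [disjoint_iff, Submodule.inf_orthogonal, h.sup_eq_top, Submodule.top_orthogonal_eq_bot]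
  · rw [codisjoint_iff, ← Submodule.orthogonal_eq_bot_iff, ← Submodule.inf_orthogonal,
      Submodule.orthogonal_orthogonal, Submodule.orthogonal_orthogonal, h.inf_eq_bot]

/-- For complementary `U` and `V`, the projection onto `Uᗮ` along `Vᗮ`. -/
def normalComponent (h : IsCompl U V) : E →ₗ[ℝ] E :=
  Submodule.projection _ _ (isCompl_orthogonal_of_isCompl h)

theorem normalComponent_mem (h : IsCompl U V) (a : E) : normalComponent h a ∈ Uᗮ :=
  Submodule.projection_apply_mem _ _

theorem normalComponent_of_mem (h : IsCompl U V) {a : E} (ha : a ∈ Uᗮ) :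
    normalComponent h a = a :=
  (Submodule.projection_eq_self_iff _ _).2 ha

theorem normalComponent_eq_zero_iff (h : IsCompl U V) {a : E} :
    normalComponent h a = 0 ↔ a ∈ Vᗮ :=
  Submodule.projection_apply_eq_zero_iff _

theorem starProjection_adjoint_normalComponent (h : IsCompl U V) {y : E} (hy : y ∈ Uᗮ) :
    Uᗮ.starProjection ((normalComponent h).adjoint y) = y := by
  refine Submodule.eq_starProjection_of_mem_of_inner_eq_zero hy fun b hb => ?_
  rw [inner_sub_left, LinearMap.adjoint_inner_left, normalComponent_of_mem h hb, sub_self]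

theorem starProjection_adjoint_normalComponent' (h : IsCompl U V) (y : E) :
    Vᗮ.starProjection ((normalComponent h).adjoint y) = 0 := by
  refine Submodule.eq_starProjection_of_mem_of_inner_eq_zero (zero_mem _) fun b hb => ?_
  rw [sub_zero, LinearMap.adjoint_inner_left, (normalComponent_eq_zero_iff h).2 hb,
    inner_zero_right]

/-- If `U` and `V` are complementary, then the two orthogonal projections identify the ambient space
with `Uᗮ × Vᗮ`, so that the intersection of two sets with normal fans along `U` and `V` is locally
the product of these fans. -/
theorem IsNormalFanAt.isFanAt_inter_of_isCompl (hX : IsNormalFanAt U 𝒦 w X 0)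
    (hY : IsNormalFanAt V ℒ v Y 0) (h : IsCompl U V) :
    IsFanAt (joinFamily 𝒦 ℒ) (Sum.elim (fun i => (normalComponent h).adjoint (w i))
      (fun i => (normalComponent h.symm).adjoint (v i))) (X ∩ Y) 0 := by
  obtain ⟨hw, hwinj, r, hr, hX⟩ := hX
  obtain ⟨hv, hvinj, r', hr', hY⟩ := hY
  have hL : ∀ c : ι ⊕ κ → ℝ, Fintype.linearCombination ℝ
      (Sum.elim (fun i => (normalComponent h).adjoint (w i))
        (fun i => (normalComponent h.symm).adjoint (v i))) c =
      (normalComponent h).adjoint (Fintype.linearCombination ℝ w fun i => c (.inl i)) +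
      (normalComponent h.symm).adjoint (Fintype.linearCombination ℝ v fun i => c (.inr i)) := by
    intro c
    simp [Fintype.linearCombination_apply]
  have hU : ∀ y z : E, y ∈ Uᗮ → Uᗮ.starProjection
      ((normalComponent h).adjoint y + (normalComponent h.symm).adjoint z) = y := fun y z hy => by
    rw [map_add, starProjection_adjoint_normalComponent h hy,
      starProjection_adjoint_normalComponent' h.symm, add_zero]
  have hV : ∀ y z : E, z ∈ Vᗮ → Vᗮ.starProjection
      ((normalComponent h).adjoint y + (normalComponent h.symm).adjoint z) = z := fun y z hz => by
    rw [map_add, starProjection_adjoint_normalComponent h.symm hz,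
      starProjection_adjoint_normalComponent' h, zero_add]
  refine ⟨fun c hc c' hc' hcc => ?_, min r r', lt_min hr hr', fun y hy => ?_⟩
  · rw [mem_supportCone_joinFamily] at hc hc'
    rw [hL, hL] at hcc
    have h1 := congrArg Uᗮ.starProjection hcc
    have h2 := congrArg Vᗮ.starProjection hcc
    rw [hU _ _ (linearCombination_mem hw _), hU _ _ (linearCombination_mem hw _)] at h1
    rw [hV _ _ (linearCombination_mem hv _), hV _ _ (linearCombination_mem hv _)] at h2
    ext i
    rcases i with i | i
    · exact congrFun (hwinj hc.1 hc'.1 h1) i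
    · exact congrFun (hvinj hc.2 hc'.2 h2) i
  · rw [mem_inter_iff, hX y (hy.trans (min_le_left _ _)), hY y (hy.trans (min_le_right _ _)),
      sub_zero]
    constructor
    · rintro ⟨⟨c, hc, hcy⟩, ⟨d, hd, hdy⟩⟩
      refine ⟨Sum.elim c d, mem_supportCone_joinFamily.2 ⟨hc, hd⟩, ?_⟩
      rw [hL]
      simp only [Sum.elim_inl, Sum.elim_inr]
      -- both sides have the same projections to `Uᗮ` and to `Vᗮ`
      refine sub_eq_zero.1 (Submodule.mem_bot ℝ |>.1 ?_)
      rw [← h.inf_eq_bot, Submodule.mem_inf, ← starProjection_orthogonal_eq_zero_iff (U := U),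
        ← starProjection_orthogonal_eq_zero_iff (U := V), map_sub, map_sub,
        hU _ _ (linearCombination_mem hw _), hV _ _ (linearCombination_mem hv _), hcy, hdy]
      simp
    · rintro ⟨c, hc, rfl⟩
      rw [mem_supportCone_joinFamily] at hc
      rw [hL, hU _ _ (linearCombination_mem hw _), hV _ _ (linearCombination_mem hv _)]
      exact ⟨⟨_, hc.1, rfl⟩, ⟨_, hc.2, rfl⟩⟩

/-- The generators of the product fan are the adjoint images of the generators of the factors, so
the direction `a` enters the two factors through its components in `Uᗮ` and `Vᗮ`. -/
theorem IsNormalFanAt.index_inter_eq (hX : IsNormalFanAt U 𝒦 w X 0) (h𝒦 : 𝒦.Nonempty)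
    (hY : IsNormalFanAt V ℒ v Y 0) (hℒ : ℒ.Nonempty) (h : IsCompl U V) (ρ : CurvatureMap.{u})
    (a : E) : ρ.index (X ∩ Y) 0 a =
      ρ.fanIndex 𝒦 w (normalComponent h a) * ρ.fanIndex ℒ v (normalComponent h.symm a) := by
  have hne : (joinFamily 𝒦 ℒ).Nonempty := ⟨_, _, h𝒦.some_mem, _, hℒ.some_mem, rfl⟩
  rw [(hX.isFanAt_inter_of_isCompl hY h).index_eq hne, CurvatureMap.fanIndex,
    CurvatureMap.modelValue_joinFamily]
  congr 2
  · ext i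
    simp [LinearMap.adjoint_inner_left]
  · ext i
    simp [LinearMap.adjoint_inner_left]

end NormalFan

/-! ### The invariant probability measure on the sphere -/

section SphereMeasure

open scoped Pointwise

variable {V : Type*} [NormedAddCommGroup V] [InnerProductSpace ℝ V] [FiniteDimensional ℝ V]
  [MeasurableSpace V] [BorelSpace V]

variable (V) in
/-- The normalized surface measure of the unit sphere as a measure on the ambient space; the unit
mass at the origin if the space is zero. It represents `sphereMean`. -/
def sphereMeasure : Measure V :=
  if Module.finrank ℝ V = 0 then Measure.dirac 0
  else (((volume : Measure V).toSphere univ)⁻¹ • (volume : Measure V).toSphere).map (↑)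

theorem sphereMean_eq_integral (f : V → ℝ) : sphereMean f = ∫ a, f a ∂sphereMeasure V := by
  rw [sphereMean, sphereMeasure]
  split_ifs with h
  · rw [integral_dirac]
  · rw [(MeasurableEmbedding.subtype_coe Metric.isClosed_sphere.measurableSet).integral_map]
    rfl

instance : IsProbabilityMeasure (sphereMeasure V) := by
  rw [sphereMeasure]
  split_ifs with h
  · infer_instance
  · have : NeZero (volume : Measure V).toSphere :=
      ⟨fun h0 => h ((Measure.toSphere_eq_zero_iff_finrank _).1 h0)⟩
    exact Measure.isProbabilityMeasure_map measurable_subtype_coe.aemeasurable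

theorem sphereMeasure_apply (h : Module.finrank ℝ V ≠ 0) {s : Set V} (hs : MeasurableSet s) :
    sphereMeasure V s = ((volume : Measure V).toSphere univ)⁻¹ *
      (Module.finrank ℝ V * volume (Ioo (0 : ℝ) 1 • (Metric.sphere (0 : V) 1 ∩ s))) := by
  rw [sphereMeasure, if_neg h, Measure.map_apply measurable_subtype_coe hs, Measure.smul_apply,
    Measure.toSphere_apply' _ (measurable_subtype_coe hs), Subtype.image_preimage_coe, smul_eq_mul]

theorem map_sphereMeasure (T : V ≃ₗᵢ[ℝ] V) : (sphereMeasure V).map T = sphereMeasure V := by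
  by_cases h : Module.finrank ℝ V = 0
  · rw [sphereMeasure, if_pos h, Measure.map_dirac' T.continuous.measurable, map_zero]
  · ext s hs
    rw [Measure.map_apply T.continuous.measurable hs, sphereMeasure_apply h hs,
      sphereMeasure_apply h (T.continuous.measurable hs)]
    have : Ioo (0 : ℝ) 1 • (Metric.sphere (0 : V) 1 ∩ T ⁻¹' s) =
        T ⁻¹' (Ioo (0 : ℝ) 1 • (Metric.sphere (0 : V) 1 ∩ s)) := by
      ext y
      simp only [Set.mem_smul, mem_preimage, mem_inter_iff, mem_sphere_zero_iff_norm]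
      constructor
      · rintro ⟨t, ht, z, ⟨hz, hzs⟩, rfl⟩
        exact ⟨t, ht, T z, ⟨by rwa [T.norm_map], hzs⟩, (map_smul T t z).symm⟩
      · rintro ⟨t, ht, z, ⟨hz, hzs⟩, hy⟩
        refine ⟨t, ht, T.symm z, ⟨by rwa [T.symm.norm_map], by rwa [T.apply_symm_apply]⟩, ?_⟩
        rw [← map_smul, hy, T.symm_apply_apply]
    rw [this]
    congr 2
    exact T.measurePreserving.measure_preimage_emb T.toHomeomorph.measurableEmbedding _

theorem sphereMeasure_submodule_eq_zero {U : Submodule ℝ V} (hU : U ≠ ⊤) :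
    sphereMeasure V (U : Set V) = 0 := by
  have h : Module.finrank ℝ V ≠ 0 := fun h => by
    have := Module.finrank_zero_iff.1 h
    exact hU (Subsingleton.elim _ _)
  rw [sphereMeasure_apply h U.closed_of_finiteDimensional.measurableSet]
  have : volume (Ioo (0 : ℝ) 1 • (Metric.sphere (0 : V) 1 ∩ U)) = 0 := by
    refine measure_mono_null ?_ (Measure.addHaar_submodule volume U hU)
    rintro _ ⟨t, -, z, hz, rfl⟩
    exact U.smul_mem _ hz.2
  rw [this, mul_zero, mul_zero]

end SphereMeasure

/-! ### Averaging over the orthogonal group -/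

section Averaging

variable {V : Type*} [NormedAddCommGroup V] [InnerProductSpace ℝ V] [FiniteDimensional ℝ V]
  [MeasurableSpace V] [BorelSpace V]

theorem continuous_orthGroup_inv_apply {T V : Type*} [TopologicalSpace T] [NormedAddCommGroup V]
    [InnerProductSpace ℝ V] [FiniteDimensional ℝ V] {g : T → OrthGroup V} (hg : Continuous g)
    {x : T → V} (hx : Continuous x) :
    Continuous fun t => (((g t)⁻¹ : OrthGroup V) : V →L[ℝ] V) (x t) :=
  (continuous_subtype_val.comp hg.inv).clm_apply hx

/-- The orthogonal group acts transitively on the sphere, so the mean of a function over an orbit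
is its mean with respect to any rotation-invariant probability measure, provided that the function
is constant along rays. -/
theorem integral_orthGroup_inv_apply {μ : Measure V} [IsProbabilityMeasure μ]
    (hμ : ∀ g : OrthGroup V, μ.map (g : V →L[ℝ] V) = μ) (hμ0 : μ {0} = 0 ∨ Subsingleton V)
    {f : V → ℝ} (hf : Measurable f) (hfb : ∃ C, ∀ x, |f x| ≤ C)
    (hfs : ∀ t : ℝ, 0 < t → ∀ x, f (t • x) = f x) {a : V} (ha : a ≠ 0 ∨ Subsingleton V) :
    ∫ g : OrthGroup V, f (((g⁻¹ : OrthGroup V) : V →L[ℝ] V) a) ∂orthHaar V = ∫ x, f x ∂μ := by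
  obtain ⟨C, hC⟩ := hfb
  -- the average over the orbit of a nonzero vector does not depend on the vector; it is computed by
  -- integrating it with respect to `μ`
  let I : V → ℝ := fun a => ∫ g : OrthGroup V, f (((g⁻¹ : OrthGroup V) : V →L[ℝ] V) a) ∂orthHaar V
  have hIk : ∀ (k : OrthGroup V) (b : V), I ((k : V →L[ℝ] V) b) = I b := fun k b => by
    have := integral_mul_left_eq_self (μ := orthHaar V)
      (fun g : OrthGroup V => f (((g⁻¹ : OrthGroup V) : V →L[ℝ] V) b)) k⁻¹
    simp only [mul_inv_rev, inv_inv, Submonoid.coe_mul, mul_apply_eq_comp] at this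
    exact this
  have hIs : ∀ t : ℝ, 0 < t → ∀ b, I (t • b) = I b := fun t ht b => by
    simp only [I, map_smul, hfs t ht]
  have hI : ∀ b c : V, b ≠ 0 → c ≠ 0 → I b = I c := fun b c hb hc => by
    have hb' := norm_pos_iff.2 hb
    have hc' := norm_pos_iff.2 hc
    have hn : ‖(‖c‖ / ‖b‖) • b‖ = ‖c‖ := by
      rw [norm_smul, norm_div, norm_norm, norm_norm, div_mul_cancel₀ _ hb'.ne']
    have := hIk (Unitary.linearIsometryEquiv.symm
      (Submodule.reflection (ℝ ∙ ((‖c‖ / ‖b‖) • b - c))ᗮ)) ((‖c‖ / ‖b‖) • b)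
    rw [Unitary.coe_symm_linearIsometryEquiv_apply] at this
    rw [← hIs _ (div_pos hc' hb') b, ← this]
    exact congrArg I (Submodule.reflection_sub hn)
  have hIae : ∀ᵐ b ∂μ, I b = I a := by
    rcases hμ0 with h0 | h0
    · rcases ha with ha | ha
      · have : ∀ᵐ b ∂μ, b ≠ 0 := by
          rw [ae_iff]
          simpa using h0
        filter_upwards [this] with b hb using hI b a hb ha
      · exact Eventually.of_forall fun b => by rw [Subsingleton.elim b a]
    · exact Eventually.of_forall fun b => by rw [Subsingleton.elim b a]
  have hcont : Continuous fun p : V × OrthGroup V => ((p.2⁻¹ : OrthGroup V) : V →L[ℝ] V) p.1 :=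
    continuous_orthGroup_inv_apply continuous_snd continuous_fst
  have hint : Integrable (fun p : V × OrthGroup V => f (((p.2⁻¹ : OrthGroup V) : V →L[ℝ] V) p.1))
      (μ.prod (orthHaar V)) :=
    Integrable.of_bound (hf.comp hcont.measurable).aestronglyMeasurable C
      (Eventually.of_forall fun p => hC _)
  have h1 : ∫ b, I b ∂μ = ∫ x, f x ∂μ := by
    rw [integral_integral_swap (f := fun b (g : OrthGroup V) =>
      f (((g⁻¹ : OrthGroup V) : V →L[ℝ] V) b)) hint]
    have : ∀ g : OrthGroup V, ∫ b, f (((g⁻¹ : OrthGroup V) : V →L[ℝ] V) b) ∂μ = ∫ x, f x ∂μ := by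
      intro g
      conv_rhs => rw [← hμ g⁻¹]
      rw [integral_map (ContinuousLinearMap.continuous _).measurable.aemeasurable
        hf.aestronglyMeasurable]
    simp [this]
  rw [← h1, integral_congr_ae hIae]
  simp [I]

variable {U W : Submodule ℝ V}

theorem map_sphereMeasure_eq_zero_or (j : W ≃ₗᵢ[ℝ] Uᗮ) :
    (sphereMeasure V).map (fun a => j.symm (Uᗮ.orthogonalProjectionOnto a)) {0} = 0 ∨
      Subsingleton W := by
  by_cases hU : U = ⊤
  · right
    have : Subsingleton Uᗮ := by
      rw [hU, Submodule.top_orthogonal_eq_bot]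
      infer_instance
    exact j.toEquiv.subsingleton
  · left
    rw [Measure.map_apply (by fun_prop) (measurableSet_singleton _)]
    convert sphereMeasure_submodule_eq_zero hU
    ext a
    simp only [mem_preimage, mem_singleton_iff, LinearIsometryEquiv.map_eq_zero_iff,
      Submodule.orthogonalProjectionOnto_eq_zero_iff, Submodule.orthogonal_orthogonal,
      SetLike.mem_coe]

/-- Averaging a function that only depends on the component normal to `U` over the rotations of the
normal space gives its mean over the sphere of the ambient space. -/
theorem integral_actFixing_inv (j : W ≃ₗᵢ[ℝ] Uᗮ) {f : V → ℝ} (hf : Measurable f)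
    (hfb : ∃ C, ∀ x, |f x| ≤ C) (hfs : ∀ t : ℝ, 0 < t → ∀ x, f (t • x) = f x)
    (hfU : ∀ x, f (Uᗮ.starProjection x) = f x) {b : V} (hb : b ∈ Uᗮ) (hb0 : b ≠ 0 ∨ Uᗮ = ⊥) :
    ∫ g : OrthGroup W, f (actFixing U j g⁻¹ b) ∂orthHaar W = ∫ a, f a ∂sphereMeasure V := by
  have hmeas : Measurable fun a : V => j.symm (Uᗮ.orthogonalProjectionOnto a) := by fun_prop
  have hfj : Measurable fun x : W => f (j x) := hf.comp (by fun_prop)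
  have := Measure.isProbabilityMeasure_map (μ := sphereMeasure V) hmeas.aemeasurable
  -- compare with the projection of the spherical measure to the normal space, read off in `W`
  have key := integral_orthGroup_inv_apply (V := W)
    (μ := (sphereMeasure V).map fun a => j.symm (Uᗮ.orthogonalProjectionOnto a))
    (f := fun x => f (j x)) (a := j.symm ⟨b, hb⟩) (fun g => ?_) (map_sphereMeasure_eq_zero_or j)
    hfj (hfb.imp fun C hC x => hC _) (fun t ht x => by simp [hfs t ht]) ?_
  · rw [integral_map hmeas.aemeasurable hfj.aestronglyMeasurable] at key
    convert key using 3 with g a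
    · exact congrArg f (actFixing_coe j g⁻¹ ⟨b, hb⟩)
    · rw [LinearIsometryEquiv.apply_symm_apply]
      exact (hfU _).symm
  · rw [Measure.map_map (ContinuousLinearMap.continuous _).measurable hmeas]
    conv_rhs => rw [← map_sphereMeasure (actFixingIsometry j g),
      Measure.map_map hmeas (actFixingIsometry j g).continuous.measurable]
    congr 1
    ext1 a
    simp [coe_actFixingIsometry, orthogonalProjectionOnto_orthogonal_actFixing]
  · rcases hb0 with h | h
    · refine Or.inl fun h0 => h ?_
      rw [LinearIsometryEquiv.map_eq_zero_iff] at h0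
      exact congrArg Subtype.val h0
    · right
      have : Subsingleton Uᗮ := by
        rw [h]
        infer_instance
      exact j.toEquiv.subsingleton

/-- The spherical mean of a function that only depends on the component normal to `U` may be
computed in the normal space. -/
theorem integral_sphereMeasure_orthogonal {f : V → ℝ} (hf : Measurable f)
    (hfb : ∃ C, ∀ x, |f x| ≤ C) (hfs : ∀ t : ℝ, 0 < t → ∀ x, f (t • x) = f x)
    (hfU : ∀ x, f (Uᗮ.starProjection x) = f x) :
    ∫ a : Uᗮ, f a ∂sphereMeasure Uᗮ = ∫ a, f a ∂sphereMeasure V := by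
  obtain ⟨b, hb⟩ : ∃ b : Uᗮ, b ≠ 0 ∨ Uᗮ = ⊥ := by
    by_cases h : Uᗮ = ⊥
    · exact ⟨0, Or.inr h⟩
    · obtain ⟨b, hb, hb0⟩ := Submodule.exists_mem_ne_zero_of_ne_bot h
      exact ⟨⟨b, hb⟩, Or.inl fun h0 => hb0 (congrArg Subtype.val h0)⟩
  have hsub : Uᗮ = ⊥ → Subsingleton Uᗮ := fun h => by
    rw [h]
    infer_instance
  rw [← integral_actFixing_inv (LinearIsometryEquiv.refl ℝ Uᗮ) hf hfb hfs hfU b.2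
    (hb.imp_left fun h h0 => h (Subtype.ext h0))]
  refine (integral_orthGroup_inv_apply (f := fun x : Uᗮ => f x) (fun g => ?_) ?_
    (hf.comp measurable_subtype_coe) (hfb.imp fun C hC x => hC _) (fun t ht x => ?_)
    (hb.imp_right hsub)).symm.trans ?_
  · exact map_sphereMeasure (Unitary.linearIsometryEquiv g)
  · by_cases h : Uᗮ = ⊥
    · exact Or.inr (hsub h)
    · left
      have hne : (⊥ : Submodule ℝ Uᗮ) ≠ ⊤ := fun h' => h (by
        rw [← Submodule.subsingleton_iff_eq_bot]
        exact (Submodule.subsingleton_iff ℝ).1 (subsingleton_of_bot_eq_top h'))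
      simpa using sphereMeasure_submodule_eq_zero hne
  · simp [hfs t ht]
  · simp only [actFixing_coe]
    rfl

end Averaging

/-! ### Curvature of intersections -/

theorem continuous_actFixing_inv {E : Type*} [NormedAddCommGroup E] [InnerProductSpace ℝ E]
    [FiniteDimensional ℝ E] {U W : Submodule ℝ E} (j : W ≃ₗᵢ[ℝ] Uᗮ) :
    Continuous fun p : OrthGroup W × E => actFixing U j p.1⁻¹ p.2 := by
  have h1 : Continuous fun p : OrthGroup W × E => ((p.1⁻¹ : OrthGroup W) : W →L[ℝ] W)
      (j.symm (Uᗮ.orthogonalProjectionOnto p.2)) :=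
    continuous_orthGroup_inv_apply (V := W) (g := fun p : OrthGroup W × E => p.1)
      (x := fun p => j.symm (Uᗮ.orthogonalProjectionOnto p.2)) continuous_fst (by fun_prop)
  have h2 : Continuous fun p : OrthGroup W × E => (U.orthogonalProjectionOnto p.2 : E) := by
    fun_prop
  exact h2.add (continuous_subtype_val.comp (j.continuous.comp h1))

section Main

variable {ι κ : Type u} [Fintype ι] [Fintype κ] {E : Type u} [NormedAddCommGroup E]
  [InnerProductSpace ℝ E] [FiniteDimensional ℝ E] [MeasurableSpace E] [BorelSpace E]
  {U V : Submodule ℝ E} {𝒦 : Set (Finset ι)} {w : ι → E} {X : Set E}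
  {ℒ : Set (Finset κ)} {v : κ → E} {Y : Set E}

theorem IsNormalFanAt.curvatureAt_inter_orthogonal (hX : IsNormalFanAt U 𝒦 w X 0)
    (h𝒦 : 𝒦.Nonempty) (ρ : CurvatureMap.{u}) :
    ρ.curvatureAt (X ∩ (Uᗮ : Submodule ℝ E)) 0 = ∫ a, ρ.fanIndex 𝒦 w a ∂sphereMeasure E := by
  have h : (AffineSubspace.mk' (0 : E) Uᗮ : Set E) = (Uᗮ : Submodule ℝ E) := by
    ext y
    simp
  have h' := hX.isFanAt_inter
  rw [h] at h'
  rw [CurvatureMap.curvatureAt, sphereMean_eq_integral]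
  simp only [h'.index_eq h𝒦]

theorem IsNormalFanAt.faceCurvature_eq {x : E} (hX : IsNormalFanAt U 𝒦 w X x)
    (h𝒦 : 𝒦.Nonempty) (ρ : CurvatureMap.{u}) {F : Set E} (hU : U = vectorSpan ℝ F) :
    ρ.faceCurvature X F x = ∫ a, ρ.fanIndex 𝒦 w a ∂sphereMeasure E := by
  rw [CurvatureMap.faceCurvature, sphereMean_eq_integral]
  subst hU
  simp only [hX.isFanAt_inter.index_eq h𝒦]
  exact integral_sphereMeasure_orthogonal (ρ.measurable_fanIndex 𝒦 w)
    (ρ.exists_abs_fanIndex_le 𝒦 w) (fun t ht x => ρ.fanIndex_smul ht x)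
    fun x => ρ.fanIndex_starProjection hX.1 x

theorem IsNormalFanAt.curvatureAt_image_inter_image (hX : IsNormalFanAt U 𝒦 w X 0)
    (h𝒦 : 𝒦.Nonempty) (hY : IsNormalFanAt V ℒ v Y 0) (hℒ : ℒ.Nonempty) (h : IsCompl U V)
    (ρ : CurvatureMap.{u}) (j₁ : U ≃ₗᵢ[ℝ] Vᗮ) (j₂ : V ≃ₗᵢ[ℝ] Uᗮ) (g : OrthGroup U × OrthGroup V) :
    ρ.curvatureAt (actFixing U j₂ g.2 '' X ∩ actFixing V j₁ g.1 '' Y) 0 =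
      ∫ a, ρ.fanIndex 𝒦 w (actFixing U j₂ g.2⁻¹ (normalComponent h a)) *
        ρ.fanIndex ℒ v (actFixing V j₁ g.1⁻¹ (normalComponent h.symm a)) ∂sphereMeasure E := by
  rw [CurvatureMap.curvatureAt, sphereMean_eq_integral]
  simp only [(hX.image_actFixing j₂ g.2).index_inter_eq h𝒦 (hY.image_actFixing j₁ g.1) hℒ h,
    CurvatureMap.fanIndex_actFixing]

theorem ae_normalComponent_ne_zero (h : IsCompl U V) :
    ∀ᵐ a ∂sphereMeasure E, normalComponent h a ≠ 0 ∨ Uᗮ = ⊥ := by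
  by_cases hU : Uᗮ = ⊥
  · exact Eventually.of_forall fun _ => Or.inr hU
  · have hV : Vᗮ ≠ ⊤ := fun hV => hU (by
      have := (isCompl_orthogonal_of_isCompl h).inf_eq_bot
      rwa [hV, inf_top_eq] at this)
    have : ∀ᵐ a ∂sphereMeasure E, a ∉ (Vᗮ : Submodule ℝ E) := by
      rw [ae_iff]
      simpa using sphereMeasure_submodule_eq_zero hV
    filter_upwards [this] with a ha
    exact Or.inl fun h0 => ha ((normalComponent_eq_zero_iff h).1 h0)

/-- The averaged product formula: for a fixed direction, the average over the rotations separates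
into a product of averages, which for almost every direction are the curvatures of the normal
fans. -/
theorem IsNormalFanAt.integrable_and_integral_curvatureAt (hX : IsNormalFanAt U 𝒦 w X 0)
    (h𝒦 : 𝒦.Nonempty) (hY : IsNormalFanAt V ℒ v Y 0) (hℒ : ℒ.Nonempty) (h : IsCompl U V)
    (ρ : CurvatureMap.{u}) (j₁ : U ≃ₗᵢ[ℝ] Vᗮ) (j₂ : V ≃ₗᵢ[ℝ] Uᗮ) :
    Integrable (fun g : OrthGroup U × OrthGroup V =>
        ρ.curvatureAt (actFixing U j₂ g.2 '' X ∩ actFixing V j₁ g.1 '' Y) 0)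
      ((orthHaar U).prod (orthHaar V)) ∧
    ∫ g : OrthGroup U × OrthGroup V,
        ρ.curvatureAt (actFixing U j₂ g.2 '' X ∩ actFixing V j₁ g.1 '' Y) 0
        ∂((orthHaar U).prod (orthHaar V)) =
      (∫ a, ρ.fanIndex 𝒦 w a ∂sphereMeasure E) * ∫ a, ρ.fanIndex ℒ v a ∂sphereMeasure E := by
  simp only [hX.curvatureAt_image_inter_image h𝒦 hY hℒ h]
  have hm₁ := ρ.measurable_fanIndex 𝒦 w
  have hm₂ := ρ.measurable_fanIndex ℒ v
  obtain ⟨C, hC⟩ := ρ.exists_abs_fanIndex_le 𝒦 w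
  obtain ⟨D, hD⟩ := ρ.exists_abs_fanIndex_le ℒ v
  have hc₁ : Continuous fun p : (OrthGroup U × OrthGroup V) × E =>
      actFixing U j₂ p.1.2⁻¹ (normalComponent h p.2) :=
    (continuous_actFixing_inv j₂).comp ((continuous_snd.comp continuous_fst).prodMk
      ((normalComponent h).continuous_of_finiteDimensional.comp continuous_snd))
  have hc₂ : Continuous fun p : (OrthGroup U × OrthGroup V) × E =>
      actFixing V j₁ p.1.1⁻¹ (normalComponent h.symm p.2) :=
    (continuous_actFixing_inv j₁).comp ((continuous_fst.comp continuous_fst).prodMk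
      ((normalComponent h.symm).continuous_of_finiteDimensional.comp continuous_snd))
  have hint : Integrable (fun p : (OrthGroup U × OrthGroup V) × E =>
      ρ.fanIndex 𝒦 w (actFixing U j₂ p.1.2⁻¹ (normalComponent h p.2)) *
        ρ.fanIndex ℒ v (actFixing V j₁ p.1.1⁻¹ (normalComponent h.symm p.2)))
      (((orthHaar U).prod (orthHaar V)).prod (sphereMeasure E)) := by
    refine Integrable.of_bound ((hm₁.comp hc₁.measurable).mul
      (hm₂.comp hc₂.measurable)).aestronglyMeasurable (C * D) (Eventually.of_forall fun p => ?_)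
    rw [Real.norm_eq_abs, abs_mul]
    exact mul_le_mul (hC _) (hD _) (abs_nonneg _) ((abs_nonneg _).trans (hC 0))
  refine ⟨hint.integral_prod_left, ?_⟩
  rw [integral_integral_swap (f := fun (g : OrthGroup U × OrthGroup V) (a : E) =>
    ρ.fanIndex 𝒦 w (actFixing U j₂ g.2⁻¹ (normalComponent h a)) *
      ρ.fanIndex ℒ v (actFixing V j₁ g.1⁻¹ (normalComponent h.symm a))) hint]
  have hae : ∀ᵐ a ∂sphereMeasure E, ∫ g : OrthGroup U × OrthGroup V,
      ρ.fanIndex 𝒦 w (actFixing U j₂ g.2⁻¹ (normalComponent h a)) *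
        ρ.fanIndex ℒ v (actFixing V j₁ g.1⁻¹ (normalComponent h.symm a))
        ∂((orthHaar U).prod (orthHaar V)) =
      (∫ a, ρ.fanIndex 𝒦 w a ∂sphereMeasure E) * ∫ a, ρ.fanIndex ℒ v a ∂sphereMeasure E := by
    filter_upwards [ae_normalComponent_ne_zero h, ae_normalComponent_ne_zero h.symm] with a ha hb
    rw [← integral_actFixing_inv j₂ hm₁ ⟨C, hC⟩ (fun t ht x => ρ.fanIndex_smul ht x)
        (fun x => ρ.fanIndex_starProjection hX.1 x) (normalComponent_mem h a) ha,
      ← integral_actFixing_inv j₁ hm₂ ⟨D, hD⟩ (fun t ht x => ρ.fanIndex_smul ht x)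
        (fun x => ρ.fanIndex_starProjection hY.1 x) (normalComponent_mem h.symm a) hb,
      mul_comm, ← integral_prod_mul]
    exact integral_congr_ae (Eventually.of_forall fun g => mul_comm _ _)
  rw [integral_congr_ae hae]
  simp

/-- In the orthogonal case no average is needed: the rotations act on the intersection by isometries
of the ambient space. -/
theorem IsNormalFanAt.curvatureAt_inter_of_isOrtho (hX : IsNormalFanAt U 𝒦 w X 0)
    (h𝒦 : 𝒦.Nonempty) (hY : IsNormalFanAt V ℒ v Y 0) (hℒ : ℒ.Nonempty) (h : IsCompl U V)
    (hUV : U = Vᗮ) (hVU : V = Uᗮ) (ρ : CurvatureMap.{u}) :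
    ρ.curvatureAt (X ∩ Y) 0 =
      (∫ a, ρ.fanIndex 𝒦 w a ∂sphereMeasure E) * ∫ a, ρ.fanIndex ℒ v a ∂sphereMeasure E := by
  let j₁ : U ≃ₗᵢ[ℝ] Vᗮ := LinearIsometryEquiv.ofEq U Vᗮ hUV
  let j₂ : V ≃ₗᵢ[ℝ] Uᗮ := LinearIsometryEquiv.ofEq V Uᗮ hVU
  have hUc : ∀ a, normalComponent h a = Uᗮ.starProjection a := fun a => by
    refine (Submodule.eq_starProjection_of_mem_orthogonal (normalComponent_mem h a) ?_).symm
    have h1 : a - normalComponent h a ∈ Vᗮ := by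
      rw [← normalComponent_eq_zero_iff h, map_sub,
        normalComponent_of_mem h (normalComponent_mem h a), sub_self]
    rw [Submodule.orthogonal_orthogonal]
    exact hUV.ge h1
  have hVc : ∀ a, normalComponent h.symm a = Vᗮ.starProjection a := fun a => by
    refine (Submodule.eq_starProjection_of_mem_orthogonal (normalComponent_mem h.symm a) ?_).symm
    have h1 : a - normalComponent h.symm a ∈ Uᗮ := by
      rw [← normalComponent_eq_zero_iff h.symm, map_sub,
        normalComponent_of_mem h.symm (normalComponent_mem h.symm a), sub_self]
    rw [Submodule.orthogonal_orthogonal]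
    exact hVU.ge h1
  have hm₁ := ρ.measurable_fanIndex 𝒦 w
  have hm₂ := ρ.measurable_fanIndex ℒ v
  have hcU := (normalComponent h).continuous_of_finiteDimensional
  have hcV := (normalComponent h.symm).continuous_of_finiteDimensional
  -- substitute `a ↦ g₂⁻¹ g₁⁻¹ a` in the mean over the directions `a`
  have hconst : ∀ g : OrthGroup U × OrthGroup V,
      ρ.curvatureAt (actFixing U j₂ g.2 '' X ∩ actFixing V j₁ g.1 '' Y) 0 =
        ρ.curvatureAt (X ∩ Y) 0 := by
    intro g
    rw [hX.curvatureAt_image_inter_image h𝒦 hY hℒ h, CurvatureMap.curvatureAt,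
      sphereMean_eq_integral]
    simp only [hX.index_inter_eq h𝒦 hY hℒ h]
    conv_rhs => rw [← map_sphereMeasure ((actFixingIsometry j₁ g.1⁻¹).trans
      (actFixingIsometry j₂ g.2⁻¹))]
    have hm : Measurable fun a => ρ.fanIndex 𝒦 w (normalComponent h a) *
        ρ.fanIndex ℒ v (normalComponent h.symm a) :=
      (hm₁.comp hcU.measurable).mul (hm₂.comp hcV.measurable)
    rw [integral_map (LinearIsometryEquiv.continuous _).measurable.aemeasurable
      hm.aestronglyMeasurable]
    have hproj : ∀ {P Q : Submodule ℝ E}, P = Q → ∀ y, P.starProjection y = Q.starProjection y := by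
      rintro _ _ rfl _
      rfl
    have hfixU : ∀ y, Uᗮ.starProjection (actFixing V j₁ g.1⁻¹ y) = Uᗮ.starProjection y := by
      intro y
      rw [← hproj hVU, ← hproj hVU, Submodule.starProjection_apply,
        orthogonalProjectionOnto_actFixing]
      rfl
    have hfixV : ∀ y, Vᗮ.starProjection (actFixing U j₂ g.2⁻¹ y) = Vᗮ.starProjection y := by
      intro y
      rw [← hproj hUV, ← hproj hUV, Submodule.starProjection_apply,
        orthogonalProjectionOnto_actFixing]
      rfl
    refine integral_congr_ae (Eventually.of_forall fun a => ?_)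
    simp only [LinearIsometryEquiv.trans_apply, coe_actFixingIsometry, hUc, hVc]
    rw [starProjection_actFixing, hfixU, hfixV, starProjection_actFixing]
  have key := (hX.integrable_and_integral_curvatureAt h𝒦 hY hℒ h ρ j₁ j₂).2
  simp only [hconst] at key
  simpa using key

end Main

end PLCurvature

end

theorem proposition3p3 {E : Type*} [NormedAddCommGroup E] [InnerProductSpace ℝ E]
    [FiniteDimensional ℝ E] [MeasurableSpace E] [BorelSpace E]
    (ρ : PLCurvature.CurvatureMap)
    -- compact PL spaces `X₁ = K₁.space`, `X₂ = K₂.space` with their faces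
    (K₁ K₂ : Geometry.SimplicialComplex ℝ E) (hK₁ : K₁.faces.Finite) (hK₂ : K₂.faces.Finite)
    (s₁ s₂ : Finset E) (hs₁ : s₁ ∈ K₁.faces) (hs₂ : s₂ ∈ K₂.faces)
    (F₁ F₂ : Set E) (hF₁ : F₁ = convexHull ℝ (s₁ : Set E)) (hF₂ : F₂ = convexHull ℝ (s₂ : Set E))
    (hF : intrinsicInterior ℝ F₁ ∩ intrinsicInterior ℝ F₂ = {0})
    (E₁ E₂ : Submodule ℝ E) (hE₁ : E₁ = Submodule.span ℝ F₁) (hE₂ : E₂ = Submodule.span ℝ F₂)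
    (hE : IsCompl E₁ E₂)
    -- base points at which the curvatures of the faces are computed
    (x₁ x₂ : E) (hx₁ : x₁ ∈ intrinsicInterior ℝ F₁) (hx₂ : x₂ ∈ intrinsicInterior ℝ F₂) :
    -- the averaged formula, `O(E₂)` and `O(E₁)` acting on the normal spaces of `E₁` and `E₂`
    (∀ (j₁ : E₁ ≃ₗᵢ[ℝ] E₂ᗮ) (j₂ : E₂ ≃ₗᵢ[ℝ] E₁ᗮ),
      Integrable (fun g : PLCurvature.OrthGroup E₁ × PLCurvature.OrthGroup E₂ =>
        ρ.curvatureAt (PLCurvature.actFixing E₁ j₂ g.2 '' K₁.space ∩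
          PLCurvature.actFixing E₂ j₁ g.1 '' K₂.space) 0)
        ((PLCurvature.orthHaar E₁).prod (PLCurvature.orthHaar E₂)) ∧
      ∫ g : PLCurvature.OrthGroup E₁ × PLCurvature.OrthGroup E₂,
        ρ.curvatureAt (PLCurvature.actFixing E₁ j₂ g.2 '' K₁.space ∩
          PLCurvature.actFixing E₂ j₁ g.1 '' K₂.space) 0
        ∂((PLCurvature.orthHaar E₁).prod (PLCurvature.orthHaar E₂)) =
      ρ.curvatureAt (K₁.space ∩ (E₁ᗮ : Submodule ℝ E)) 0 *
        ρ.curvatureAt (K₂.space ∩ (E₂ᗮ : Submodule ℝ E)) 0) ∧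
    ρ.curvatureAt (K₁.space ∩ (E₁ᗮ : Submodule ℝ E)) 0 *
        ρ.curvatureAt (K₂.space ∩ (E₂ᗮ : Submodule ℝ E)) 0 =
      ρ.faceCurvature K₁.space F₁ x₁ * ρ.faceCurvature K₂.space F₂ x₂ ∧
    -- the orthogonal case
    (E₁ ⟂ E₂ →
      ρ.curvatureAt (K₁.space ∩ K₂.space) 0 =
        ρ.curvatureAt (K₁.space ∩ E₂) 0 * ρ.curvatureAt (K₂.space ∩ E₁) 0 ∧
      ρ.curvatureAt (K₁.space ∩ E₂) 0 * ρ.curvatureAt (K₂.space ∩ E₁) 0 =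
        ρ.faceCurvature K₁.space F₁ x₁ * ρ.faceCurvature K₂.space F₂ x₂) := by
  subst hF₁ hF₂
  have h0 : (0 : E) ∈ intrinsicInterior ℝ (convexHull ℝ (s₁ : Set E)) ∩
      intrinsicInterior ℝ (convexHull ℝ (s₂ : Set E)) := by
    rw [hF]
    exact mem_singleton 0
  -- since the origin lies in both faces, the span of a face is its direction
  have hspan : ∀ F : Set E, (0 : E) ∈ F → Submodule.span ℝ F = vectorSpan ℝ F := fun F hF => by
    rw [vectorSpan_eq_span_vsub_set_right ℝ hF]
    simp
  have hU₁ := hE₁.trans (hspan _ (intrinsicInterior_subset h0.1))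
  have hU₂ := hE₂.trans (hspan _ (intrinsicInterior_subset h0.2))
  have := PLCurvature.finite_vertexType hK₁
  have := PLCurvature.finite_vertexType hK₂
  have := Fintype.ofFinite (PLCurvature.VertexType K₁)
  have := Fintype.ofFinite (PLCurvature.VertexType K₂)
  have hX₁ := PLCurvature.isNormalFanAt_space hU₁ h0.1 hK₁ hs₁ h0.1
  have hX₂ := PLCurvature.isNormalFanAt_space hU₂ h0.2 hK₂ hs₂ h0.2
  have hn₁ := PLCurvature.linkFamily_nonempty hs₁
  have hn₂ := PLCurvature.linkFamily_nonempty hs₂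
  have hf₁ := (PLCurvature.isNormalFanAt_space hU₁ h0.1 hK₁ hs₁ hx₁).faceCurvature_eq hn₁ ρ hU₁
  have hf₂ := (PLCurvature.isNormalFanAt_space hU₂ h0.2 hK₂ hs₂ hx₂).faceCurvature_eq hn₂ ρ hU₂
  have hc₁ := hX₁.curvatureAt_inter_orthogonal hn₁ ρ
  have hc₂ := hX₂.curvatureAt_inter_orthogonal hn₂ ρ
  refine ⟨fun j₁ j₂ => ?_, ?_, fun hperp => ?_⟩
  · rw [hc₁, hc₂]
    exact hX₁.integrable_and_integral_curvatureAt hn₁ hX₂ hn₂ hE ρ j₁ j₂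
  · rw [hc₁, hc₂, hf₁, hf₂]
  · have h₁ : E₁ = E₂ᗮ :=
      eq_of_le_of_inf_le_of_sup_le hperp
        ((disjoint_iff_inf_le.1 E₂.orthogonal_disjoint.symm).trans bot_le)
        (le_top.trans hE.sup_eq_top.ge)
    have h₂ : E₂ = E₁ᗮ := by rw [h₁, Submodule.orthogonal_orthogonal]
    rw [← h₂] at hc₁
    rw [← h₁] at hc₂
    rw [hc₁, hc₂, hf₁, hf₂]
    exact ⟨hX₁.curvatureAt_inter_of_isOrtho hn₁ hX₂ hn₂ hE h₁ h₂ ρ, rfl⟩
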